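/- **Setting.** Let $k$ be a field and let $Q$ be a quiver of Dynkin type $A$ with vertices $1,\dots,n$ ($n\ge 1$) from left to right and arbitrary orientation; write $A_i$ (resp. $B_i$) for the matrix of a representation on the left arrow $i\leftarrow i+1$ (resp. the right arrow $i\to i+1$). Let $\mathbf d$ be a dimension vector with $d_x\neq 0$ for all $x$, $N=\sum_x d_x$, $G=\mathrm{GL}_N(k)$, $B$ and $B^-$ the subgroups of upper and lower triangular matrices. $\mathrm{GL}(\mathbf d)=\prod_x \mathrm{GL}_{d_x}(k)$ acts on $rep_Q(\mathbf d)$ by $(g\cdot V)_\alpha=g_{t(\alpha)}V_\alpha g_{s(\alpha)}^{-1}$. For $a<b$ let $r_{[a,b]}(V)$ be the rank of the map $\bigoplus_{x}V_x\to\bigoplus_{y}V_y$ from the sources $x$ to the sinks $y$ of the full subquiver $Q_{[a,b]}$ on $a,\dots,b$, whose components are the maps of $V$ along the paths from $x$ to $y$ (zero if there is none). If $\mathbf r=(r_{[a,b]}(V_0))_{a<b}$ for a representation $V_0\in rep_Q(\mathbf d)$, then $\mathcal O_{\mathbf r}=\mathrm{GL}(\mathbf d)\cdot V_0$. Let $R_1,\dots,R_r$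 and $L_1,\dots,L_l$ be the maximal rightward and leftward paths of $Q$, numbered from the left, each being ordered along its arrows, with start $s(\cdot)$ and end $t(\cdot)$, and let the vertices be ordered in the two sequences $$S_1=R_1\setminus t(R_1),\dots,R_r\setminus t(R_r),\ n,\ L_l\setminus s(L_l),\dots,L_1\setminus s(L_1),$$ $$S_2=L_l\setminus t(L_l),\dots,L_1\setminus t(L_1),\ 1,\ R_1\setminus s(R_1),\dots,R_r\setminus s(R_r).$$ Divide $N\times N$ matrices into blocks, with block rows labelled by $S_1$ from top to bottom and block columns labelled by $S_2$ from left to right, the row or column $[x]$ having size $d_x$. For such a matrix $M$ let $M_{[x]\times[y]}$ be the southwest submatrix bounded by row $[x]$ and column $[y]$ (inclusive). Let $P$ be the group of invertible matrices that are block upper triangular for the partition of $\{1,\dots,N\}$ given by $S_2$. View $w\in S_N$ as the matrix with $(i,j)$-entry $1$ if $i=w(j)$ and $0$ otherwise, let $W^P\subset S_N$ be the set of the $w$ that are increasing on each block of columns, and let $X_w^\circ=BwP/P$ and $X^v_\circ=B^-vP/P$ in $G/P$. Let $v_Q$ be the permutation with $([x],[x])$-blocks $I_{d_x}$ and all other blocks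 $0$. Let $\mathbb A_Q$ be the space of the matrices with $([x],[x])$-blocks $I_{d_x}$ and with $([x],[y])$-block $0$ whenever $x$ precedes $y$ in $S_1$ or in $S_2$; it is identified with $X^{v_Q}_\circ$ by $M\mapsto MP$. The Zelevinsky map $\zeta_Q:rep_Q(\mathbf d)\to\mathbb A_Q$ sends $V$ to the matrix whose $([x],[y])$-block is $I_{d_x}$ if $x=y$; $B_{x-1}\cdots B_{y+1}B_y$ if $y<x$ and there is a path from $y$ to $x$; $A_x$ if $y=x+1$ and the arrow goes from $y$ to $x$; and $0$ otherwise. **Proposition.** Let $W_{\mathbf r}$ be the set of all $w\in W^P$ such that $\operatorname{rank} w_{[x]\times[y]}=\operatorname{rank}\zeta_Q(V)_{[x]\times[y]}$ for all $V\in\mathcal O_{\mathbf r}$ and all vertices $x,y$. Then, in $G/P$, $$\zeta_Q(\mathcal O_{\mathbf r})=\Big(\bigcup_{w\in W_{\mathbf r}}X_w^\circ\Big)\cap X^{v_Q}_\circ=\bigcup_{w\in W_{\mathbf r}}\big(X_w^\circ\cap X^{v_Q}_\circ\big).$$ -/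

import Mathlib

/-! ### Type A quivers and their representations

A quiver of Dynkin type `A` on the vertices `0, 1, …, n` (leftmost to rightmost) is given by the
orientation `o : Fin n → Bool` of its edges: the edge `i` joins the vertices `i` and `i + 1`, and it
is the right arrow `i → i + 1` if `o i = true`, the left arrow `i ← i + 1` if `o i = false`. -/

namespace TypeA

section Quiver

/-- A representation `V = (A, B)` of the quiver with orientation `o` and dimension vector `d`: a
matrix `B i : k ^ d i → k ^ d (i+1)` on every right arrow and a matrix
`A i : k ^ d (i+1) → k ^ d i` on every left arrow. -/
@[ext]
structure Rep (k : Type*) {n : ℕ} (o : Fin n → Bool) (d : Fin (n + 1) → ℕ) where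
  B : ∀ i : Fin n, o i = true → Matrix (Fin (d i.succ)) (Fin (d i.castSucc)) k
  A : ∀ i : Fin n, o i = false → Matrix (Fin (d i.castSucc)) (Fin (d i.succ)) k

variable {k : Type*} [Field k] {n : ℕ} {o : Fin n → Bool} {d : Fin (n + 1) → ℕ}

/-- The group `GL(d) = ∏ₓ GL(d x)`. -/
abbrev GLd (k : Type*) [Field k] {n : ℕ} (d : Fin (n + 1) → ℕ) : Type _ :=
  ∀ x : Fin (n + 1), GL (Fin (d x)) k

/-- The base change action `(g • V)_α = g_{t(α)} V_α g_{s(α)}⁻¹`. -/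
instance : MulAction (GLd k d) (Rep k o d) where
  smul g V :=
    { B := fun i h => (g i.succ).val * V.B i h * (g i.castSucc)⁻¹.val
      A := fun i h => (g i.castSucc).val * V.A i h * (g i.succ)⁻¹.val }
  one_smul V := by
    change Rep.mk _ _ = V
    ext i h : 3 <;> simp
  mul_smul g g' V := by
    change Rep.mk _ _ = Rep.mk _ _
    congr 1 <;> funext i h <;> simp only [Pi.mul_apply, mul_inv_rev, Units.val_mul]
    · change _ = _ * (_ * _ * _) * _
      simp only [Matrix.mul_assoc]
    · change _ = _ * (_ * _ * _) * _
      simp only [Matrix.mul_assoc]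

/-- The matrix with ones on the diagonal; it is only used for `m = p`, where it is the identity
(the sizes are kept apart to avoid casts). -/
def idBlock (k : Type*) [Field k] (m p : ℕ) : Matrix (Fin m) (Fin p) k :=
  Matrix.of fun a b => if (a : ℕ) = b then 1 else 0

/-- `rightMap V y x : k ^ d y → k ^ d x` is the product `B_{x-1} ⋯ B_{y+1} B_y` along the path from
`y` rightwards to `x`. It is the identity if `x = y`, and `0` if `x < y` or if some edge between
`y` and `x` is a left arrow. -/
def rightMap (V : Rep k o d) (y : Fin (n + 1)) :
    ∀ x : Fin (n + 1), Matrix (Fin (d x)) (Fin (d y)) k :=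
  Fin.induction (if y = 0 then idBlock k _ _ else 0) fun i M =>
    if y = i.succ then idBlock k _ _ else if h : o i = true then V.B i h * M else 0

/-- `leftMap V x y : k ^ d y → k ^ d x` is the product `A_x A_{x+1} ⋯ A_{y-1}` along the path from
`y` leftwards to `x`. It is the identity if `x = y`, and `0` if `y < x` or if some edge between
`x` and `y` is a right arrow. -/
def leftMap (V : Rep k o d) (x : Fin (n + 1)) :
    ∀ y : Fin (n + 1), Matrix (Fin (d x)) (Fin (d y)) k :=
  Fin.induction (if x = 0 then idBlock k _ _ else 0) fun i M =>
    if x = i.succ then idBlock k _ _ else if h : o i = false then M * V.A i h else 0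

/-- The matrix of `V` along the path from `y` to `x`, and `0` if there is no such path. -/
def pathMap (V : Rep k o d) (x y : Fin (n + 1)) : Matrix (Fin (d x)) (Fin (d y)) k :=
  if y ≤ x then rightMap V y x else leftMap V x y

/-- `x` is a source of the subquiver `Q_[a,b]`. -/
def IsSourceOn (o : Fin n → Bool) (a b x : Fin (n + 1)) : Prop :=
  a ≤ x ∧ x ≤ b ∧ ∀ i : Fin n, a ≤ i.castSucc → i.succ ≤ b →
    (i.castSucc = x → o i = true) ∧ (i.succ = x → o i = false)

/-- `x` is a sink of the subquiver `Q_[a,b]`. -/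
def IsSinkOn (o : Fin n → Bool) (a b x : Fin (n + 1)) : Prop :=
  a ≤ x ∧ x ≤ b ∧ ∀ i : Fin n, a ≤ i.castSucc → i.succ ≤ b →
    (i.castSucc = x → o i = false) ∧ (i.succ = x → o i = true)

open Classical in
/-- `r_[a,b](V)`, for `a < b`: the rank of the map
`⨁_{y source of Q_[a,b]} V_y → ⨁_{x sink of Q_[a,b]} V_x` whose components are the maps of `V`
along the paths. -/
noncomputable def rankOn (V : Rep k o d) (a b : Fin (n + 1)) : ℕ :=
  (Matrix.of fun (p : Σ x : {x // IsSinkOn o a b x}, Fin (d x.1))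
      (q : Σ y : {y // IsSourceOn o a b y}, Fin (d y.1)) =>
    pathMap V p.1.1 q.1.1 p.2 q.2).rank

/-- `O` is the orbit `𝒪_r`: the `GL(d)`-orbit of some representation `V₀` whose ranks
`r_[a,b](V₀)` are the given numbers `r_[a,b]`. In particular, `r` is a rank parameter. -/
def IsOrbitOf (O : Set (Rep k o d)) (r : Fin (n + 1) → Fin (n + 1) → ℕ) : Prop :=
  ∃ V₀ : Rep k o d, (∀ a b, a < b → rankOn V₀ a b = r a b) ∧ O = MulAction.orbit (GLd k d) V₀

end Quiver

/-! ### Blocked matrices, flag varieties and cells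

A sequence `S` of all the vertices is a permutation `S : Equiv.Perm (Fin (n + 1))`; the vertex in
position `p` is `S p`, so that `x ≺ y` in `S` means `S.symm x < S.symm y`. -/

section Cells

variable {k : Type*} [Field k] {n : ℕ} {d : Fin (n + 1) → ℕ}

/-- The numbering of rows (or columns) by the sequence `S`: the numbers `0, …, N - 1`, where
`N = ∑ₓ d x`, are cut into consecutive intervals of lengths `d (S 0), d (S 1), …, d (S n)`, and a
number is sent to the label of its interval together with its place there. -/
def index (d : Fin (n + 1) → ℕ) (S : Equiv.Perm (Fin (n + 1))) :
    Fin (∑ x, d x) ≃ Σ x : Fin (n + 1), Fin (d x) :=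
  (finCongr (Equiv.sum_comp S d).symm).trans <|
    (finSigmaFinEquiv (n := fun p => d (S p))).symm.trans <|
      Equiv.sigmaCongrLeft (β := fun x => Fin (d x)) S

/-- The position in `S` of the label of the row (column) `i`. -/
def pos (d : Fin (n + 1) → ℕ) (S : Equiv.Perm (Fin (n + 1))) (i : Fin (∑ x, d x)) : Fin (n + 1) :=
  S.symm (index d S i).1

/-- The `(S', S)`-blocked matrix with the `([x],[y])`-blocks `F x y`. -/
def blocked (S' S : Equiv.Perm (Fin (n + 1)))
    (F : ∀ x y : Fin (n + 1), Matrix (Fin (d x)) (Fin (d y)) k) :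
    Matrix (Fin (∑ x, d x)) (Fin (∑ x, d x)) k :=
  Matrix.of fun i j =>
    F (index d S' i).1 (index d S j).1 (index d S' i).2 (index d S j).2

/-- The rank of the southwest submatrix `M_{[x]×[y]}` of an `(S', S)`-blocked matrix: the rows
whose label is `x` or is south of `x`, the columns whose label is `y` or is west of `y`. -/
noncomputable def swRank (S' S : Equiv.Perm (Fin (n + 1)))
    (M : Matrix (Fin (∑ x, d x)) (Fin (∑ x, d x)) k) (x y : Fin (n + 1)) : ℕ :=
  (M.submatrix (fun i : {i // S'.symm x ≤ pos d S' i} => i.1)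
    (fun j : {j // pos d S j ≤ S.symm y} => j.1)).rank

/-- The subgroup of the matrices that are upper triangular for the (block) labels `b`. -/
def upper (k : Type*) [Field k] {N : ℕ} {β : Type*} [LinearOrder β] (b : Fin N → β) :
    Subgroup (GL (Fin N) k) where
  carrier := {g | g.val.BlockTriangular b}
  one_mem' := Matrix.blockTriangular_one
  mul_mem' hg hh := hg.mul hh
  inv_mem' {g} hg := by
    have : Invertible g.val := g.invertible
    have h := Matrix.blockTriangular_inv_of_blockTriangular (M := g.val) hg
    simpa only [Set.mem_ofPred_eq, Matrix.coe_units_inv] using h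

/-- The Borel subgroup `B` of upper triangular matrices. -/
def borel (k : Type*) [Field k] (N : ℕ) : Subgroup (GL (Fin N) k) :=
  upper k (id : Fin N → Fin N)

/-- The opposite Borel subgroup `B⁻` of lower triangular matrices. -/
def borelOpp (k : Type*) [Field k] (N : ℕ) : Subgroup (GL (Fin N) k) :=
  upper k (OrderDual.toDual : Fin N → (Fin N)ᵒᵈ)

/-- The parabolic subgroup `P` of block upper triangular `(S, S)`-blocked matrices. -/
def parabolic (k : Type*) [Field k] (d : Fin (n + 1) → ℕ) (S : Equiv.Perm (Fin (n + 1))) :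
    Subgroup (GL (Fin (∑ x, d x)) k) :=
  upper k (pos d S)

/-- The set of points of the partial flag variety `G/P`, where `G = GL(N)`. -/
abbrev Flag (k : Type*) [Field k] (d : Fin (n + 1) → ℕ) (S : Equiv.Perm (Fin (n + 1))) : Type _ :=
  GL (Fin (∑ x, d x)) k ⧸ parabolic k d S

/-- The permutation matrix of `w`: its `(i, j)`-entry is `1` if `i = w j`, and `0` otherwise. -/
def permMat (k : Type*) [Field k] {N : ℕ} (w : Equiv.Perm (Fin N)) : Matrix (Fin N) (Fin N) k :=
  Matrix.of fun i j => if i = w j then 1 else 0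

theorem permMat_mul_symm {N : ℕ} (w : Equiv.Perm (Fin N)) :
    permMat k w * permMat k w.symm = 1 := by
  ext i j
  simp [permMat, Matrix.mul_apply, Matrix.one_apply]

/-- The permutation matrix of `w` as an element of `GL(N)`. -/
def permGL (k : Type*) [Field k] {N : ℕ} (w : Equiv.Perm (Fin N)) : GL (Fin N) k where
  val := permMat k w
  inv := permMat k w.symm
  val_inv := permMat_mul_symm w
  inv_val := by simpa using permMat_mul_symm (k := k) w.symm

/-- `W^P`: the permutations that are increasing on every block of columns. -/
def minReps (d : Fin (n + 1) → ℕ) (S : Equiv.Perm (Fin (n + 1))) :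
    Set (Equiv.Perm (Fin (∑ x, d x))) :=
  {w | ∀ i j, pos d S i = pos d S j → i < j → w i < w j}

/-- The Schubert cell `X_w^∘ = BwP/P`. -/
def schubertCell (k : Type*) [Field k] (S : Equiv.Perm (Fin (n + 1)))
    (w : Equiv.Perm (Fin (∑ x, d x))) : Set (Flag k d S) :=
  {q | ∃ b ∈ borel k (∑ x, d x), q = QuotientGroup.mk (b * permGL k w)}

/-- The opposite Schubert cell `X^v_∘ = B⁻vP/P`. -/
def oppCell (k : Type*) [Field k] (S : Equiv.Perm (Fin (n + 1)))
    (v : Equiv.Perm (Fin (∑ x, d x))) : Set (Flag k d S) :=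
  {q | ∃ b ∈ borelOpp k (∑ x, d x), q = QuotientGroup.mk (b * permGL k v)}

/-- The permutation `v` which, as an `(S', S)`-blocked matrix, has identity matrices as
`([x],[x])`-blocks and zero blocks elsewhere. -/
def blockPerm (d : Fin (n + 1) → ℕ) (S' S : Equiv.Perm (Fin (n + 1))) :
    Equiv.Perm (Fin (∑ x, d x)) :=
  (index d S).trans (index d S').symm

/-- The affine space of `(S', S)`-blocked matrices whose `([x],[y])`-block is the identity if
`x = y`, zero if `x ≺ y` in `S` or in `S'`, and arbitrary otherwise. -/
def affineCell (k : Type*) [Field k] (d : Fin (n + 1) → ℕ) (S' S : Equiv.Perm (Fin (n + 1))) :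
    Set (Matrix (Fin (∑ x, d x)) (Fin (∑ x, d x)) k) :=
  {M | ∃ F : ∀ x y : Fin (n + 1), Matrix (Fin (d x)) (Fin (d y)) k,
    (∀ x, F x x = 1) ∧ (∀ x y, S.symm x < S.symm y ∨ S'.symm x < S'.symm y → F x y = 0) ∧
    M = blocked S' S F}

theorem isUnit_of_mem_affineCell {S' S : Equiv.Perm (Fin (n + 1))}
    {M : Matrix (Fin (∑ x, d x)) (Fin (∑ x, d x)) k} (hM : M ∈ affineCell k d S' S) :
    IsUnit M := by
  obtain ⟨F, h1, h0, rfl⟩ := hM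
  have hdet : (Matrix.of fun p q : Σ x : Fin (n + 1), Fin (d x) => F p.1 q.1 p.2 q.2).det = 1 := by
    rw [Matrix.BlockTriangular.det_fintype (b := fun p => OrderDual.toDual (S.symm p.1))]
    · refine Finset.prod_eq_one fun a _ => ?_
      convert Matrix.det_one (n := {p : Σ x : Fin (n + 1), Fin (d x) //
        OrderDual.toDual (S.symm p.1) = a}) (R := k)
      ext ⟨⟨x, s⟩, hp⟩ ⟨⟨y, t⟩, hq⟩
      obtain rfl : x = y := by
        have := hp.trans hq.symm
        simpa using this
      simp [Matrix.toSquareBlock_def, h1, Matrix.one_apply]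
    · intro p q hpq
      simp only [OrderDual.toDual_lt_toDual] at hpq
      simp [h0 _ _ (Or.inl hpq)]
  have hM : blocked S' S F = (Matrix.of fun p q : Σ x : Fin (n + 1), Fin (d x) =>
      F p.1 q.1 p.2 q.2).submatrix (index d S') (index d S) := rfl
  rw [hM, Matrix.isUnit_submatrix_equiv, Matrix.isUnit_iff_isUnit_det, hdet]
  exact isUnit_one

/-- The map `M ↦ MP` by which the affine space of matrices is identified with the opposite cell
`B⁻vP/P ⊆ G/P`, where `v = blockPerm d S' S`. -/
noncomputable def toFlag {S' S : Equiv.Perm (Fin (n + 1))} (M : affineCell k d S' S) :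
    Flag k d S :=
  QuotientGroup.mk (isUnit_of_mem_affineCell M.2).unit

end Cells

/-! ### The Zelevinsky map -/

section Zelevinsky

variable {k : Type*} [Field k] {n : ℕ} {o : Fin n → Bool} {d : Fin (n + 1) → ℕ}

/-- The vertex `x` is the left end of a right arrow, i.e. it lies in some `R_i ∖ t(R_i)`. -/
def StartsRight (o : Fin n → Bool) (x : Fin (n + 1)) : Prop :=
  ∃ i : Fin n, i.castSucc = x ∧ o i = true

/-- The vertex `x` is the right end of a right arrow, i.e. it lies in some `R_i ∖ s(R_i)`. -/
def EndsRight (o : Fin n → Bool) (x : Fin (n + 1)) : Prop :=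
  ∃ i : Fin n, i.succ = x ∧ o i = true

open Classical in
/-- A key that increases along the sequence `S₁`. -/
noncomputable def key₁ (o : Fin n → Bool) (x : Fin (n + 1)) : ℤ :=
  if StartsRight o x then ((x : ℕ) : ℤ) - n else (n : ℤ) - (x : ℕ)

open Classical in
/-- A key that increases along the sequence `S₂`. -/
noncomputable def key₂ (o : Fin n → Bool) (x : Fin (n + 1)) : ℤ :=
  if EndsRight o x then ((x : ℕ) : ℤ) else -((x : ℕ) : ℤ)

/-- The sequence
`S₁ = R_1∖t(R_1) ◁ ⋯ ◁ R_r∖t(R_r) ◁ {last} ◁ L_l∖s(L_l) ◁ ⋯ ◁ L_1∖s(L_1)`, where `R_1, R_2, …`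
and `L_1, L_2, …` are the maximal rightward and leftward paths, counted from the left: first the
left ends of the right arrows, in increasing order; then the rightmost vertex (key `0`); then the
left ends of the left arrows, in decreasing order. -/
noncomputable def seq₁ (o : Fin n → Bool) : Equiv.Perm (Fin (n + 1)) := Tuple.sort (key₁ o)

/-- The sequence
`S₂ = L_l∖t(L_l) ◁ ⋯ ◁ L_1∖t(L_1) ◁ {first} ◁ R_1∖s(R_1) ◁ ⋯ ◁ R_r∖s(R_r)`: first the right ends
of the left arrows, in decreasing order; then the leftmost vertex (key `0`); then the right ends
of the right arrows, in increasing order. -/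
noncomputable def seq₂ (o : Fin n → Bool) : Equiv.Perm (Fin (n + 1)) := Tuple.sort (key₂ o)

/-- The `([x],[y])`-block of the Zelevinsky matrix: the product `B_{x-1} ⋯ B_y` if there is a path
from `y` rightwards to `x` (the identity if `x = y`), the matrix `A_x` if `y = x + 1` and the arrow
goes from `y` to `x`, and `0` otherwise. -/
def zetaBlock (V : Rep k o d) (x y : Fin (n + 1)) : Matrix (Fin (d x)) (Fin (d y)) k :=
  if y ≤ x then rightMap V y x else if (y : ℕ) = x + 1 then leftMap V x y else 0

/-- The Zelevinsky matrix `ζ_Q(V)`. -/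
noncomputable def zetaMatrix (V : Rep k o d) : Matrix (Fin (∑ x, d x)) (Fin (∑ x, d x)) k :=
  blocked (seq₁ o) (seq₂ o) (zetaBlock V)

theorem symm_sort_lt {m : ℕ} {f : Fin m → ℤ} {x y : Fin m}
    (h : (Tuple.sort f).symm x < (Tuple.sort f).symm y) : f x ≤ f y := by
  simpa using Tuple.monotone_sort f h.le

theorem rightMap_self (V : Rep k o d) (x : Fin (n + 1)) : rightMap V x x = 1 := by
  have h : idBlock k (d x) (d x) = 1 := by
    ext a b
    simp [idBlock, Matrix.one_apply, Fin.ext_iff]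
  cases x using Fin.cases with
  | zero => simpa [rightMap] using h
  | succ i => simpa [rightMap] using h

theorem startsRight_of_rightMap_ne_zero (V : Rep k o d) {x y : Fin (n + 1)} (hlt : y < x)
    (h : rightMap V y x ≠ 0) : StartsRight o y ∧ EndsRight o x := by
  induction x using Fin.induction with
  | zero => exact absurd hlt (Fin.not_lt_zero y)
  | succ i ih =>
    have hR : rightMap V y i.succ =
        if h : o i = true then V.B i h * rightMap V y i.castSucc else 0 := by
      simp [rightMap, hlt.ne]
    rw [hR] at h
    split_ifs at h with hi
    · refine ⟨?_, i, rfl, hi⟩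
      rcases (Fin.le_castSucc_iff.2 hlt).eq_or_lt with he | hl
      · exact ⟨i, he.symm, hi⟩
      · exact (ih hl fun h0 => h (by rw [h0, Matrix.mul_zero])).1
    · exact absurd rfl h

theorem zetaMatrix_mem (V : Rep k o d) :
    zetaMatrix V ∈ affineCell k d (seq₁ o) (seq₂ o) := by
  refine ⟨zetaBlock V, fun x => by simp [zetaBlock, rightMap_self], fun x y hxy => ?_, rfl⟩
  have hne : x ≠ y := by rintro rfl; simp at hxy
  have hkey : key₂ o x ≤ key₂ o y ∨ key₁ o x ≤ key₁ o y :=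
    hxy.imp symm_sort_lt symm_sort_lt
  unfold zetaBlock
  split_ifs with hle hy
  · have hlt : y < x := lt_of_le_of_ne hle hne.symm
    by_contra hR
    obtain ⟨hs, he⟩ := startsRight_of_rightMap_ne_zero V hlt hR
    have h1 : key₁ o y = ((y : ℕ) : ℤ) - n := if_pos hs
    have h2 : key₂ o x = ((x : ℕ) : ℤ) := if_pos he
    have h3 : ((x : ℕ) : ℤ) - n ≤ key₁ o x := by unfold key₁; split_ifs <;> omega
    have h4 : key₂ o y ≤ ((y : ℕ) : ℤ) := by unfold key₂; split_ifs <;> omega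
    have h5 : (y : ℕ) < x := hlt
    rcases hkey with h | h <;> omega
  · obtain ⟨i, rfl⟩ : ∃ i : Fin n, i.castSucc = x := ⟨⟨x, by have := y.2; omega⟩, rfl⟩
    obtain rfl : i.succ = y := by ext; simp [hy]
    rcases hi : o i with _ | _
    · have hs : ¬ StartsRight o i.castSucc := by
        rintro ⟨j, hj, ho⟩
        rw [Fin.castSucc_injective _ hj, hi] at ho
        exact Bool.false_ne_true ho
      have he : ¬ EndsRight o i.succ := by
        rintro ⟨j, hj, ho⟩
        rw [Fin.succ_injective _ hj, hi] at ho
        exact Bool.false_ne_true ho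
      have h1 : key₁ o i.castSucc = (n : ℤ) - ((i.castSucc : Fin (n + 1)) : ℕ) := if_neg hs
      have h2 : key₂ o i.succ = -(((i.succ : Fin (n + 1)) : ℕ) : ℤ) := if_neg he
      have h3 : key₁ o i.succ ≤ (n : ℤ) - ((i.succ : Fin (n + 1)) : ℕ) := by
        unfold key₁; split_ifs <;> omega
      have h4 : -(((i.castSucc : Fin (n + 1)) : ℕ) : ℤ) ≤ key₂ o i.castSucc := by
        unfold key₂; split_ifs <;> omega
      simp only [Fin.val_succ, Fin.val_castSucc] at h1 h2 h3 h4
      rcases hkey with h | h <;> omega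
    · have : i.castSucc ≠ i.succ := hne
      simp [leftMap, this, hi]
  · rfl

/-- The Zelevinsky map `ζ_Q` from representations to the affine space of matrices `𝔸_Q`. -/
noncomputable def zeta (V : Rep k o d) : affineCell k d (seq₁ o) (seq₂ o) :=
  ⟨zetaMatrix V, zetaMatrix_mem V⟩

/-- The permutation `v_Q`. -/
noncomputable def vQ (o : Fin n → Bool) (d : Fin (n + 1) → ℕ) : Equiv.Perm (Fin (∑ x, d x)) :=
  blockPerm d (seq₁ o) (seq₂ o)

/-- The permutations `w ∈ W^P` satisfying (ZP1) for the orbit `O`: the southwest block ranks of `w`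
are those of `ζ_Q(V)` for every `V ∈ O`. -/
def zp1 (O : Set (Rep k o d)) : Set (Equiv.Perm (Fin (∑ x, d x))) :=
  {w | w ∈ minReps d (seq₂ o) ∧ ∀ V ∈ O, ∀ x y : Fin (n + 1),
    swRank (seq₁ o) (seq₂ o) (permMat k w) x y = swRank (seq₁ o) (seq₂ o) (zetaMatrix V) x y}

end Zelevinsky

end TypeA

/-! Southwest block ranks do not change under left multiplication by `B` or right multiplication by
`P`. They are therefore constant on each Schubert cell, and by the Bruhat decomposition the cells of
the `w ∈ W^P` cover `G/P`. They are also constant on the orbit `O` of `V₀`. So a point of the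
opposite cell lies in the union exactly when its matrix `M ∈ 𝔸_Q` has the southwest ranks of
`ζ(V₀)`, and what must be shown is that such an `M` is `ζ(V)` for some `V ∈ O`.

The tool is the factorization `ζ(V) = (1 + A)(1 - B)⁻¹`, where `A` and `B` are the sums of the maps
on the left and right arrows. Whenever `M = TQ⁻¹`, rank-nullity turns a southwest rank of `M` into
the dimension of the space of the `w` such that `Qw` vanishes on the columns left out and `Tw` on
the rows kept (`finrank_nullSpace_add_blockRank`).

`M` is a Zelevinsky matrix (`exists_eq_zetaBlock`): write `M = 1 + L + U` with `L`, `U` strictly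
lower and upper triangular for the natural order of the vertices. The blocks of `U` beyond the first
superdiagonal vanish because some southwest ranks of `ζ(V₀)` are `0`, so `U = A` comes from left
arrows. Put `(1 + L)⁻¹ = 1 - R`; the shape of `𝔸_Q` gives `AR = 0`, hence `M(1 - R) = 1 + A`.
Comparing null spaces for `M` and `ζ(V₀)` shows that `R` is concentrated on the first subdiagonal,
so `R = B`.

The ranks determine the orbit (`mem_orbit_of_blockRank_eq`): each `V x` is filtered by pushing
forward along right arrows and pulling back along left arrows, starting at the leftmost vertex. The
dimensions of the steps are differences of dimensions of null spaces (`finrank_filt_add`), so equal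
ranks give filtrations of equal dimensions. An isomorphism is then built from the rightmost vertex
leftwards, by lifting or extending a filtered isomorphism across one arrow at a time. -/

namespace TypeA

/-! ### Ranks of submatrices under triangular multiplication -/

section SubmatrixRank

variable {k : Type*} [Field k] {m n : Type*} [Fintype n]

open Classical in
/-- The rank of the submatrix formed by the rows satisfying `p` and the columns satisfying `q`. -/
noncomputable def subRank (M : Matrix m n k) (p : m → Prop) (q : n → Prop) : ℕ :=
  (M.submatrix (fun i : {i // p i} => i.1) (fun j : {j // q j} => j.1)).rank

/-- By the vanishing hypothesis, the submatrix of the product is itself a product, with the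
submatrix of `M` as right factor. -/
theorem subRank_mul_left_le [Fintype m] (X : Matrix m m k) (M : Matrix m n k) {p : m → Prop}
    (q : n → Prop) (h : ∀ i i', p i → ¬ p i' → X i i' = 0) :
    subRank (X * M) p q ≤ subRank M p q := by
  classical
  have : (X * M).submatrix (fun i : {i // p i} => i.1) (fun j : {j // q j} => j.1) =
      X.submatrix (fun i : {i // p i} => i.1) (fun i : {i // p i} => i.1) *
        M.submatrix (fun i : {i // p i} => i.1) (fun j : {j // q j} => j.1) := by
    ext i j
    simp only [Matrix.submatrix_apply, Matrix.mul_apply]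
    rw [← Fintype.sum_subtype_add_sum_subtype p, add_eq_left]
    exact Finset.sum_eq_zero fun l _ => by rw [h i.1 l.1 i.2 l.2, zero_mul]
  unfold subRank
  rw [this]
  exact Matrix.rank_mul_le_right _ _

theorem subRank_mul_right_le (M : Matrix m n k) (Y : Matrix n n k) (p : m → Prop) {q : n → Prop}
    (h : ∀ j' j, ¬ q j' → q j → Y j' j = 0) : subRank (M * Y) p q ≤ subRank M p q := by
  classical
  have : (M * Y).submatrix (fun i : {i // p i} => i.1) (fun j : {j // q j} => j.1) =
      M.submatrix (fun i : {i // p i} => i.1) (fun j : {j // q j} => j.1) *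
        Y.submatrix (fun j : {j // q j} => j.1) (fun j : {j // q j} => j.1) := by
    ext i j
    simp only [Matrix.submatrix_apply, Matrix.mul_apply]
    rw [← Fintype.sum_subtype_add_sum_subtype q, add_eq_left]
    exact Finset.sum_eq_zero fun l _ => by rw [h l.1 j.1 l.2 j.2, mul_zero]
  unfold subRank
  rw [this]
  exact Matrix.rank_mul_le_left _ _

theorem subRank_submatrix_equiv {m' n' : Type*} [Fintype n'] (M : Matrix m n k)
    (e : m' ≃ m) (f : n' ≃ n) (p : m → Prop) (q : n → Prop) :
    subRank (M.submatrix e f) (fun i => p (e i)) (fun j => q (f j)) = subRank M p q := by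
  classical
  unfold subRank
  rw [← Matrix.rank_submatrix (M.submatrix (fun i : {i // p i} => i.1) (fun j : {j // q j} => j.1))
    (e.subtypeEquiv (p := fun i => p (e i)) (q := p) fun _ => Iff.rfl)
    (f.subtypeEquiv (p := fun i => q (f i)) (q := q) fun _ => Iff.rfl)]
  rfl

end SubmatrixRank

/-! ### Southwest ranks are constant on Schubert cells -/

section Flags

variable {k : Type*} [Field k] {n : ℕ} {d : Fin (n + 1) → ℕ}

theorem finSigmaFinEquiv_lt {m : ℕ} {f : Fin m → ℕ} {a b : Σ i, Fin (f i)} (h : a.1 < b.1) :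
    finSigmaFinEquiv a < finSigmaFinEquiv b := by
  obtain ⟨p, s⟩ := a
  obtain ⟨q, t⟩ := b
  let g : ℕ → ℕ := fun i => if hi : i < m then f ⟨i, hi⟩ else 0
  have key : ∀ r : Fin m, ∑ i : Fin r, f (Fin.castLE r.2.le i) = ∑ i ∈ Finset.range r, g i := by
    intro r
    rw [← Fin.sum_univ_eq_sum_range]
    refine Finset.sum_congr rfl fun i _ => ?_
    simp [g, i.2.trans r.2, Fin.castLE]
  rw [Fin.lt_def, finSigmaFinEquiv_apply, finSigmaFinEquiv_apply, key, key]
  have hs : (s : ℕ) < g p := by simp [g]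
  have hle : ∑ i ∈ Finset.range (p + 1), g i ≤ ∑ i ∈ Finset.range q, g i :=
    Finset.sum_le_sum_of_subset (Finset.range_subset_range.2 (show (p : ℕ) + 1 ≤ q from h))
  rw [Finset.sum_range_succ] at hle
  dsimp only
  change _ + (s : ℕ) < _ + (t : ℕ)
  omega

/-- The blocks are consecutive intervals, so triangular matrices are block triangular for every
sequence `S`. This is what makes `B` preserve southwest regions and lie in `P`. -/
theorem pos_mono (S : Equiv.Perm (Fin (n + 1))) : Monotone (pos d S) := by
  intro i j hij
  have hpos : ∀ i, pos d S i = (finSigmaFinEquiv (n := fun p => d (S p)).symm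
      (finCongr (Equiv.sum_comp S d).symm i)).1 := by
    intro i
    simp [pos, index, Equiv.sigmaCongrLeft]
  rw [hpos, hpos]
  by_contra hlt
  have := finSigmaFinEquiv_lt (not_le.1 hlt)
  simp only [Equiv.apply_symm_apply] at this
  exact absurd hij (not_le.2 (by simpa using this))

theorem swRank_eq_subRank (S' S : Equiv.Perm (Fin (n + 1)))
    (M : Matrix (Fin (∑ x, d x)) (Fin (∑ x, d x)) k) (x y : Fin (n + 1)) :
    swRank S' S M x y =
      subRank M (fun i => S'.symm x ≤ pos d S' i) (fun j => pos d S j ≤ S.symm y) := by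
  unfold swRank subRank
  congr!

theorem swRank_mul_left_le {S' S : Equiv.Perm (Fin (n + 1))}
    {b : GL (Fin (∑ x, d x)) k} (hb : b ∈ borel k (∑ x, d x))
    (M : Matrix (Fin (∑ x, d x)) (Fin (∑ x, d x)) k) (x y : Fin (n + 1)) :
    swRank S' S (b.val * M) x y ≤ swRank S' S M x y := by
  rw [swRank_eq_subRank, swRank_eq_subRank]
  refine subRank_mul_left_le _ _ _ fun i i' hi hi' => hb ?_
  by_contra h
  exact hi' (hi.trans (pos_mono S' (not_lt.1 h)))

theorem swRank_mul_right_le {S' S : Equiv.Perm (Fin (n + 1))}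
    {p : GL (Fin (∑ x, d x)) k} (hp : p ∈ parabolic k d S)
    (M : Matrix (Fin (∑ x, d x)) (Fin (∑ x, d x)) k) (x y : Fin (n + 1)) :
    swRank S' S (M * p.val) x y ≤ swRank S' S M x y := by
  rw [swRank_eq_subRank, swRank_eq_subRank]
  refine subRank_mul_right_le _ _ _ fun i i' hi hi' => hp ?_
  exact lt_of_le_of_lt hi' (not_le.1 hi)

/-- The inequality for `b` and the one for `b⁻¹` together give equality. -/
theorem swRank_mul_left {S' S : Equiv.Perm (Fin (n + 1))}
    {b : GL (Fin (∑ x, d x)) k} (hb : b ∈ borel k (∑ x, d x))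
    (M : Matrix (Fin (∑ x, d x)) (Fin (∑ x, d x)) k) (x y : Fin (n + 1)) :
    swRank S' S (b.val * M) x y = swRank S' S M x y := by
  refine le_antisymm (swRank_mul_left_le hb M x y) ?_
  have h := swRank_mul_left_le (S' := S') (S := S) (inv_mem hb) (b.val * M) x y
  rwa [← Matrix.mul_assoc, Units.inv_mul, Matrix.one_mul] at h

theorem swRank_mul_right {S' S : Equiv.Perm (Fin (n + 1))}
    {p : GL (Fin (∑ x, d x)) k} (hp : p ∈ parabolic k d S)
    (M : Matrix (Fin (∑ x, d x)) (Fin (∑ x, d x)) k) (x y : Fin (n + 1)) :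
    swRank S' S (M * p.val) x y = swRank S' S M x y := by
  refine le_antisymm (swRank_mul_right_le hp M x y) ?_
  have h := swRank_mul_right_le (S' := S') (S := S) (inv_mem hp) (M * p.val) x y
  rwa [Matrix.mul_assoc, Units.mul_inv, Matrix.mul_one] at h

theorem borel_le_parabolic (S : Equiv.Perm (Fin (n + 1))) :
    borel k (∑ x, d x) ≤ parabolic k d S := by
  intro g hg i j hij
  exact hg (lt_of_not_ge fun h => absurd hij (not_lt.2 (pos_mono S h)))

/-- Two representatives of one coset in a Schubert cell have the same southwest ranks. -/
theorem swRank_eq_of_mem_schubertCell {S' S : Equiv.Perm (Fin (n + 1))}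
    {w : Equiv.Perm (Fin (∑ x, d x))} {g : GL (Fin (∑ x, d x)) k}
    (h : (QuotientGroup.mk g : Flag k d S) ∈ schubertCell k S w) (x y : Fin (n + 1)) :
    swRank S' S g.val x y = swRank S' S (permMat k w) x y := by
  obtain ⟨b, hb, h⟩ := h
  have hp := QuotientGroup.eq.1 h.symm
  have hg : g.val = b.val * permMat k w * ((b * permGL k w)⁻¹ * g).val := by
    change g.val = (b * permGL k w).val * _
    rw [← Units.val_mul, mul_inv_cancel_left]
  rw [hg, swRank_mul_right hp, swRank_mul_left hb]

end Flags

/-! ### The Bruhat decomposition by Gaussian elimination -/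

section Bruhat

variable {k : Type*} [Field k] {N : ℕ}

theorem exists_mem_borel_val_eq {X : Matrix (Fin N) (Fin N) k} (h : X.BlockTriangular id)
    (hd : ∀ i, X i i ≠ 0) : ∃ b ∈ borel k N, b.val = X := by
  have hdet : X.det ≠ 0 := by
    rw [Matrix.det_of_isUpperTriangular h]
    exact Finset.prod_ne_zero_iff.2 fun i _ => hd i
  exact ⟨Matrix.GeneralLinearGroup.mkOfDetNeZero X hdet, h, rfl⟩

/-- The column `j` of `m` is a unit vector, and so is the row of its nonzero entry. -/
def IsCleared (m : Matrix (Fin N) (Fin N) k) (j : Fin N) : Prop :=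
  ∃ i, (∀ a, m a j = if a = i then 1 else 0) ∧ ∀ c, m i c = if c = j then 1 else 0

/-- The pivot is the lowest nonzero entry of column `j`. Column operations to the right clear its
row and row operations upwards clear its column; both are upper triangular. -/
theorem exists_clear_column (g : GL (Fin N) k) (j : Fin N) (h : ∀ c < j, IsCleared g.val c) :
    ∃ b ∈ borel k N, ∃ p ∈ borel k N, ∀ c ≤ j, IsCleared (b * g * p).val c := by
  classical
  set m := g.val with hm
  obtain ⟨i, hi, hmax⟩ : ∃ i, m i j ≠ 0 ∧ ∀ a, i < a → m a j = 0 := by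
    have hne : (Finset.univ.filter fun i => m i j ≠ 0).Nonempty := by
      by_contra hE
      rw [Finset.not_nonempty_iff_eq_empty, Finset.filter_eq_empty_iff] at hE
      have h0 : m.det = 0 := Matrix.det_eq_zero_of_column_eq_zero j fun i => by
        simpa using hE (Finset.mem_univ i)
      exact ((Matrix.isUnit_iff_isUnit_det _).1 g.isUnit).ne_zero h0
    refine ⟨Finset.max' _ hne, (Finset.mem_filter.1 (Finset.max'_mem _ hne)).2, fun a ha => ?_⟩
    by_contra h0
    exact absurd (Finset.le_max' _ a (by simpa using h0)) (not_le.2 ha)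
  -- The matrices used are `p = 1 + e_j vᵀ`, which rescales column `j` to make the pivot `1` and
  -- clears the pivot row to its right, and `b = 1 + u e_iᵀ`, which then clears the entries above
  -- the pivot.
  let v : Fin N → k := fun c =>
    if c = j then (m i j)⁻¹ - 1 else if j < c then -(m i c) / m i j else 0
  let u : Fin N → k := fun a => if a < i then -(m a j) / m i j else 0
  obtain ⟨p, hp, hpv⟩ := exists_mem_borel_val_eq
    (X := 1 + Matrix.of fun a c => if a = j then v c else 0)
    (by
      refine Matrix.blockTriangular_one.add fun a c hca => ?_
      have hca : c < a := hca
      simp only [Matrix.of_apply]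
      split_ifs with haj
      · subst haj
        simp [v, hca.ne, hca.not_gt]
      · rfl)
    (by
      intro a
      by_cases haj : a = j
      · simp [v, haj, hi]
      · simp [haj])
  obtain ⟨b, hb, hbv⟩ := exists_mem_borel_val_eq
    (X := 1 + Matrix.of fun a c => if c = i then u a else 0)
    (by
      refine Matrix.blockTriangular_one.add fun a c hca => ?_
      have hca : c < a := hca
      simp only [Matrix.of_apply]
      split_ifs with haj
      · subst haj
        simp [u, hca.not_gt]
      · rfl)
    (by
      intro a
      by_cases haj : a = i
      · simp [u, haj]
      · simp [haj])
  -- The pivot row avoids the unit rows of the earlier columns, since column `j` vanishes there.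
  -- Hence the row operations leave the cleared columns alone.
  have hpiv : ∀ c < j, m i c = 0 := by
    intro c hc
    obtain ⟨i', h1, h2⟩ := h c hc
    rw [h1, if_neg]
    rintro rfl
    rw [h2, if_neg hc.ne'] at hi
    exact hi rfl
  have hmp : ∀ a c, (m * p.val) a c = m a c + m a j * v c := by
    intro a c
    rw [hpv, Matrix.mul_add, Matrix.mul_one, Matrix.add_apply]
    simp [Matrix.mul_apply]
  have hrow : ∀ c, (m * p.val) i c = if c = j then 1 else 0 := by
    intro c
    rw [hmp]
    rcases lt_trichotomy c j with hc | hc | hc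
    · simp [v, hc.ne, hc.not_gt, hpiv c hc]
    · subst hc
      simp only [v, if_true]
      field_simp
      ring
    · simp only [v, hc.ne', if_false, hc, if_true]
      field_simp
      ring
  have hent : ∀ a c, (b * g * p).val a c = m a c + m a j * v c + if c = j then u a else 0 := by
    intro a c
    rw [mul_assoc, Units.val_mul, Units.val_mul, ← hm, hbv, Matrix.add_mul, Matrix.one_mul,
      Matrix.add_apply, hmp]
    congr 1
    simp [Matrix.mul_apply (M := Matrix.of _), hrow]
  refine ⟨b, hb, p, hp, fun c hc => ?_⟩
  rcases hc.lt_or_eq with hc | rfl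
  · obtain ⟨i', h1, h2⟩ := h c hc
    have h0 : m i' j = 0 := by rw [h2, if_neg hc.ne']
    refine ⟨i', fun a => ?_, fun c' => ?_⟩
    · rw [hent, ← h1]
      simp [v, hc.ne, hc.not_gt]
    · rw [hent, h0, h2]
      simp [u, h0]
  · refine ⟨i, fun a => ?_, fun c' => ?_⟩
    · rw [hent]
      rcases lt_trichotomy a i with ha | ha | ha
      · simp only [v, u, ha, ha.ne, if_true, if_false]
        field_simp
        ring
      · subst ha
        simp only [v, u, lt_irrefl, if_true, if_false]
        field_simp
        ring
      · simp [v, u, ha.ne', ha.not_gt, hmax a ha]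
    · have := hrow c'
      rw [hmp] at this
      rw [hent, this]
      simp [u]

theorem exists_clear (g : GL (Fin N) k) (t : ℕ) :
    ∃ b ∈ borel k N, ∃ p ∈ borel k N, ∀ c : Fin N, (c : ℕ) < t → IsCleared (b * g * p).val c := by
  induction t with
  | zero => exact ⟨1, one_mem _, 1, one_mem _, fun c hc => absurd hc (Nat.not_lt_zero _)⟩
  | succ t ih =>
    obtain ⟨b, hb, p, hp, h⟩ := ih
    by_cases ht : t < N
    · obtain ⟨b', hb', p', hp', h'⟩ := exists_clear_column (b * g * p) ⟨t, ht⟩ fun c hc => h c hc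
      refine ⟨b' * b, mul_mem hb' hb, p * p', mul_mem hp hp', fun c hc => ?_⟩
      rw [show b' * b * g * (p * p') = b' * (b * g * p) * p' by group]
      exact h' c (Fin.le_def.2 (Nat.lt_succ_iff.1 hc))
    · exact ⟨b, hb, p, hp, fun c _ => h c (c.2.trans_le (not_lt.1 ht))⟩

/-- The Bruhat decomposition of `GL(N)`. -/
theorem exists_bruhat (g : GL (Fin N) k) :
    ∃ b ∈ borel k N, ∃ w : Equiv.Perm (Fin N), ∃ p ∈ borel k N, g = b * permGL k w * p := by
  obtain ⟨b, hb, p, hp, h⟩ := exists_clear g N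
  -- `f c` is the row of the single `1` in column `c`; the condition on rows makes `f` injective, so
  -- the reduced matrix is a permutation matrix.
  choose f hf hf' using fun c => h c c.2
  have hinj : Function.Injective f := by
    intro c c' hcc
    have h1 := hf' c c'
    rw [hcc, hf' c' c', if_pos rfl] at h1
    by_contra hne
    rw [if_neg (Ne.symm hne)] at h1
    exact one_ne_zero h1
  let w := Equiv.ofBijective f (Finite.injective_iff_bijective.1 hinj)
  have hw : b * g * p = permGL k w := by
    ext i j
    rw [hf j i]
    rfl
  refine ⟨b⁻¹, inv_mem hb, w, p⁻¹, inv_mem hp, ?_⟩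
  rw [← hw]
  group

end Bruhat

/-! ### Minimal representatives cover the flag variety -/

section Flags

variable {k : Type*} [Field k] {n : ℕ} {d : Fin (n + 1) → ℕ}

/-- Sort the columns by block first and by the value of `w` second. The blocks are already in order,
so the sorting permutation moves columns only inside their blocks. -/
theorem exists_mem_minReps (S : Equiv.Perm (Fin (n + 1))) (w : Equiv.Perm (Fin (∑ x, d x))) :
    ∃ σ : Equiv.Perm (Fin (∑ x, d x)), (∀ i, pos d S (σ i) = pos d S i) ∧
      σ.trans w ∈ minReps d S := by
  let key : Fin (∑ x, d x) → Fin (n + 1) ×ₗ Fin (∑ x, d x) := fun j => toLex (pos d S j, w j)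
  have hmono := Tuple.monotone_sort key
  set σ := Tuple.sort key
  have hpos : pos d S ∘ σ = pos d S ∘ (1 : Equiv.Perm (Fin (∑ x, d x))) := by
    refine Tuple.unique_monotone (fun i j hij => ?_) (fun i j hij => pos_mono S hij)
    rcases (Prod.Lex.le_iff.1 (hmono hij)) with h | h
    · exact le_of_lt h
    · exact le_of_eq h.1
  refine ⟨σ, fun i => congrFun hpos i, fun i j hij hlt => ?_⟩
  rcases (Prod.Lex.le_iff.1 (hmono hlt.le)) with h | h
  · have h : pos d S (σ i) < pos d S (σ j) := h
    have h1 : pos d S (σ i) = pos d S i := congrFun hpos i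
    have h2 : pos d S (σ j) = pos d S j := congrFun hpos j
    exact absurd hij (by rw [← h1, ← h2]; exact h.ne)
  · exact lt_of_le_of_ne h.2 fun he => hlt.ne ((σ.trans w).injective he)

/-- The Schubert cells of the minimal representatives cover the flag variety. -/
theorem exists_mem_schubertCell (S : Equiv.Perm (Fin (n + 1))) (q : Flag k d S) :
    ∃ w ∈ minReps d S, q ∈ schubertCell k S w := by
  obtain ⟨g, rfl⟩ := QuotientGroup.mk_surjective q
  obtain ⟨b, hb, w, p, hp, rfl⟩ := exists_bruhat g
  obtain ⟨σ, hσ, hw⟩ := exists_mem_minReps S w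
  refine ⟨_, hw, b, hb, QuotientGroup.eq.2 ?_⟩
  have hperm : permGL k (σ.trans w) = permGL k w * permGL k σ := by
    ext i j
    rw [Units.val_mul]
    simp only [permGL, permMat, Matrix.mul_apply, Matrix.of_apply, mul_ite, mul_one, mul_zero,
      Finset.sum_ite_eq', Finset.mem_univ, if_true]
    rfl
  rw [hperm, show (b * permGL k w * p)⁻¹ * (b * (permGL k w * permGL k σ)) = p⁻¹ * permGL k σ by
    group]
  -- The permutation matrix of `σ` lies in `P`, since `σ` preserves the blocks.
  refine mul_mem (inv_mem (borel_le_parabolic S hp)) fun i j hij => if_neg ?_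
  rintro rfl
  rw [hσ] at hij
  exact lt_irrefl _ hij

end Flags

/-! ### The affine space of matrices is the opposite cell -/

section OppositeCells

variable {k : Type*} [Field k] {n : ℕ} {d : Fin (n + 1) → ℕ}

/-- The principal submatrix of `b` on the indices of `I` from `z` on is lower triangular with
nonzero diagonal, hence invertible. The rows of `I` above `z` give `0` automatically, because `b` is
lower triangular and `u` starts at `z`. -/
theorem exists_lowerTriangular_solve {N : ℕ} {b : Matrix (Fin N) (Fin N) k}
    (hb : b.BlockTriangular OrderDual.toDual) (hd : ∀ i, b i i ≠ 0) (I : Fin N → Prop)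
    {z : Fin N} (hz : I z) :
    ∃ u : Fin N → k, (∀ y, ¬ I y → u y = 0) ∧ (∀ y, y < z → u y = 0) ∧
      ∀ x, I x → ∑ y, b x y * u y = if x = z then 1 else 0 := by
  classical
  let J : Fin N → Prop := fun y => I y ∧ z ≤ y
  let b' : Matrix {y // J y} {y // J y} k := b.submatrix Subtype.val Subtype.val
  have hdet : IsUnit b'.det := by
    rw [Matrix.det_of_isLowerTriangular b' fun i j hij => hb (show _ from hij)]
    exact isUnit_iff_ne_zero.2 (Finset.prod_ne_zero_iff.2 fun i _ => hd i)
  let u' : {y // J y} → k := b'⁻¹.mulVec (Pi.single ⟨z, hz, le_rfl⟩ 1)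
  have hu' : b'.mulVec u' = Pi.single ⟨z, hz, le_rfl⟩ 1 := by
    rw [Matrix.mulVec_mulVec, Matrix.mul_nonsing_inv _ hdet, Matrix.one_mulVec]
  refine ⟨fun y => if h : J y then u' ⟨y, h⟩ else 0, fun y hy => dif_neg fun h => hy h.1,
    fun y hy => dif_neg fun h => not_lt.2 h.2 hy, fun x hx => ?_⟩
  rw [← Fintype.sum_subtype_add_sum_subtype J]
  have h2 : ∑ y : {y // ¬ J y}, b x y * (if h : J y then u' ⟨y, h⟩ else 0) = 0 :=
    Finset.sum_eq_zero fun y _ => by rw [dif_neg y.2, mul_zero]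
  rw [h2, add_zero]
  by_cases hxz : z ≤ x
  · have := congrFun hu' ⟨x, hx, hxz⟩
    simp only [Pi.single_apply, Subtype.mk.injEq] at this
    rw [← this]
    refine Finset.sum_congr rfl fun y _ => ?_
    dsimp only
    rw [dif_pos y.2]
    rfl
  · rw [if_neg fun h => hxz h.ge]
    refine Finset.sum_eq_zero fun y _ => ?_
    rw [hb (show x < y.1 from (not_le.1 hxz).trans_le y.2.2), zero_mul]

theorem diag_ne_zero_of_mem_borelOpp {N : ℕ} {b : GL (Fin N) k} (hb : b ∈ borelOpp k N)
    (i : Fin N) : b.val i i ≠ 0 := by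
  have h := ((Matrix.isUnit_iff_isUnit_det _).1 b.isUnit).ne_zero
  rw [Matrix.det_of_isLowerTriangular b.val hb] at h
  exact Finset.prod_ne_zero_iff.1 h i (Finset.mem_univ i)

/-- `Mv⁻¹` has rows and columns both ordered by `S'`, and the zero and identity blocks of `M` make
it lower triangular. -/
theorem toFlag_mem_oppCell {S' S : Equiv.Perm (Fin (n + 1))} (M : affineCell k d S' S) :
    toFlag M ∈ oppCell k S (blockPerm d S' S) := by
  obtain ⟨M, hM⟩ := M
  have hM' := hM
  obtain ⟨F, h1, h0, hF⟩ := hM'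
  refine ⟨(isUnit_of_mem_affineCell hM).unit * (permGL k (blockPerm d S' S))⁻¹, ?_, ?_⟩
  · intro i j hij
    have hij : i < j := hij
    have hent : ((isUnit_of_mem_affineCell hM).unit * (permGL k (blockPerm d S' S))⁻¹).val i j =
        F (index d S' i).1 (index d S' j).1 (index d S' i).2 (index d S' j).2 := by
      rw [Units.val_mul]
      change (M * permMat k (blockPerm d S' S).symm) i j = _
      simp only [permMat, Matrix.mul_apply, Matrix.of_apply, mul_ite, mul_one, mul_zero,
        Finset.sum_ite_eq', Finset.mem_univ, if_true, hF, blocked]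
      simp only [blockPerm, Equiv.symm_trans_apply, Equiv.symm_symm]
      rw [Equiv.apply_symm_apply]
    rw [hent]
    rcases (pos_mono (d := d) S' hij.le).lt_or_eq with h | h
    · rw [h0 _ _ (Or.inr h)]
      rfl
    · have hne : index d S' i ≠ index d S' j := fun h => hij.ne ((index d S').injective h)
      replace h : (index d S' i).1 = (index d S' j).1 := S'.symm.injective h
      generalize index d S' i = p at h hne
      generalize index d S' j = q at h hne
      obtain ⟨x, s⟩ := p
      obtain ⟨y, t⟩ := q
      obtain rfl : x = y := h
      rw [h1, Matrix.one_apply_ne]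
      rintro rfl
      exact hne rfl
  · rw [inv_mul_cancel_right]
    rfl

/-- Column reduction of `bv` by an element of `P`: each column is replaced by a combination of
columns in blocks weakly to its west in `S`, chosen so that the rows with those labels become a unit
vector. The zeros prescribed by `S'` hold because the combinations involve only columns of `b` from
`z` on. -/
theorem exists_toFlag_eq {S' S : Equiv.Perm (Fin (n + 1))} {q : Flag k d S}
    (hq : q ∈ oppCell k S (blockPerm d S' S)) : ∃ M : affineCell k d S' S, toFlag M = q := by
  obtain ⟨b, hb, rfl⟩ := hq
  set v := blockPerm d S' S with hv
  have hex := fun z => exists_lowerTriangular_solve hb (diag_ne_zero_of_mem_borelOpp hb)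
    (fun y => S.symm (index d S' y).1 ≤ S.symm (index d S' z).1) (z := z) le_rfl
  choose u hu1 hu2 hu3 using hex
  let F : ∀ x y : Fin (n + 1), Matrix (Fin (d x)) (Fin (d y)) k := fun x y => Matrix.of fun s t =>
    ∑ l, b.val ((index d S').symm ⟨x, s⟩) l * u ((index d S').symm ⟨y, t⟩) l
  have hM : blocked S' S F ∈ affineCell k d S' S := by
    refine ⟨F, fun x => ?_, fun x y hxy => ?_, rfl⟩
    · ext s t
      simp only [F, Matrix.of_apply]
      rw [hu3 _ _ (by simp)]
      simp [Matrix.one_apply]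
    · ext s t
      simp only [F, Matrix.of_apply, Matrix.zero_apply]
      rcases hxy with hxy | hxy
      · rw [hu3 _ _ (by simpa using hxy.le), if_neg]
        intro h
        have := congrArg Sigma.fst ((index d S').symm.injective h)
        exact hxy.ne (congrArg S.symm this)
      · refine Finset.sum_eq_zero fun l _ => ?_
        have hlt : (index d S').symm ⟨x, s⟩ < (index d S').symm ⟨y, t⟩ := by
          by_contra h
          have := pos_mono (d := d) S' (not_lt.1 h)
          simp only [pos, Equiv.apply_symm_apply] at this
          exact absurd hxy (not_lt.2 this)
        by_cases h : l < (index d S').symm ⟨y, t⟩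
        · rw [hu2 _ _ h, mul_zero]
        · have h0 : b.val ((index d S').symm ⟨x, s⟩) l = 0 := hb (hlt.trans_le (not_lt.1 h))
          rw [h0, zero_mul]
  refine ⟨⟨_, hM⟩, (QuotientGroup.eq.2 ?_).symm⟩
  -- `U` collects the coefficients of the column operations; its support condition `hu1` says that
  -- it is block upper triangular.
  set U : Matrix (Fin (∑ x, d x)) (Fin (∑ x, d x)) k := Matrix.of fun l j => u (v j) (v l)
  have hU : ((b * permGL k v)⁻¹ * (isUnit_of_mem_affineCell hM).unit).val = U := by
    have : (isUnit_of_mem_affineCell hM).unit.val = (b * permGL k v).val * U := by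
      ext i j
      have hbv : ∀ l, (b * permGL k v).val i l = b.val i (v l) := by
        intro l
        rw [Units.val_mul]
        simp [permGL, permMat, Matrix.mul_apply]
      rw [Matrix.mul_apply]
      simp only [hbv, U, Matrix.of_apply]
      rw [Equiv.sum_comp v fun l => b.val i l * u (v j) l]
      simp [blocked, F, v, blockPerm]
    rw [Units.val_mul, this, Units.inv_mul_cancel_left]
  change Matrix.BlockTriangular _ _
  rw [hU]
  intro l j hjl
  refine hu1 _ _ (not_le.2 ?_)
  simpa [v, blockPerm, pos] using hjl

end OppositeCells

/-! ### Comparison of vertices through the keys -/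

section Keys

variable {n : ℕ} (o : Fin n → Bool)

theorem startsRight_castSucc {o : Fin n → Bool} {i : Fin n} :
    StartsRight o i.castSucc ↔ o i = true :=
  ⟨fun ⟨_, hj, h⟩ => Fin.castSucc_injective _ hj ▸ h, fun h => ⟨i, rfl, h⟩⟩

theorem endsRight_succ {o : Fin n → Bool} {i : Fin n} : EndsRight o i.succ ↔ o i = true :=
  ⟨fun ⟨_, hj, h⟩ => Fin.succ_injective _ hj ▸ h, fun h => ⟨i, rfl, h⟩⟩

theorem not_endsRight_zero : ¬ EndsRight o 0 := fun ⟨i, hi, _⟩ => Fin.succ_ne_zero i hi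

theorem key₁_castSucc (i : Fin n) :
    key₁ o i.castSucc = if o i = true then (i : ℤ) - n else (n : ℤ) - i := by
  simp [key₁, startsRight_castSucc]

theorem key₂_succ (i : Fin n) :
    key₂ o i.succ = if o i = true then (i : ℤ) + 1 else -((i : ℤ) + 1) := by
  simp [key₂, endsRight_succ]

theorem key₂_zero : key₂ o 0 = 0 := by
  simp [key₂, not_endsRight_zero]

theorem key₁_of_startsRight {o : Fin n → Bool} {x : Fin (n + 1)} (h : StartsRight o x) :
    key₁ o x = ((x : ℕ) : ℤ) - n := if_pos h

theorem key₁_of_not_startsRight {o : Fin n → Bool} {x : Fin (n + 1)} (h : ¬ StartsRight o x) :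
    key₁ o x = (n : ℤ) - (x : ℕ) := if_neg h

theorem key₂_of_endsRight {o : Fin n → Bool} {x : Fin (n + 1)} (h : EndsRight o x) :
    key₂ o x = ((x : ℕ) : ℤ) := if_pos h

theorem key₂_of_not_endsRight {o : Fin n → Bool} {x : Fin (n + 1)} (h : ¬ EndsRight o x) :
    key₂ o x = -((x : ℕ) : ℤ) := if_neg h

theorem StartsRight.lt {o : Fin n → Bool} {x : Fin (n + 1)} (h : StartsRight o x) :
    (x : ℕ) < n := by
  obtain ⟨i, rfl, _⟩ := h
  simp

theorem EndsRight.pos {o : Fin n → Bool} {x : Fin (n + 1)} (h : EndsRight o x) :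
    0 < (x : ℕ) := by
  obtain ⟨i, rfl, _⟩ := h
  simp

/-- Left ends of right arrows have negative keys and all other vertices nonnegative ones; within
each class the key is strictly monotone in the vertex. Thus sorting has no ties, and order in the
sequence is order of keys. -/
theorem key₁_injective : Function.Injective (key₁ o) := by
  intro x y h
  have hx := x.2
  have hy := y.2
  by_cases hsx : StartsRight o x <;> by_cases hsy : StartsRight o y <;>
    simp only [key₁, hsx, hsy, if_true, if_false] at h
  · ext; omega
  · have := hsx.lt; omega
  · have := hsy.lt; omega
  · ext; omega

theorem key₂_injective : Function.Injective (key₂ o) := by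
  intro x y h
  by_cases hsx : EndsRight o x <;> by_cases hsy : EndsRight o y <;>
    simp only [key₂, hsx, hsy, if_true, if_false] at h
  · ext; omega
  · have := hsx.pos; omega
  · have := hsy.pos; omega
  · ext; omega

theorem symm_sort_le_iff {m : ℕ} {f : Fin m → ℤ} (hf : Function.Injective f) {x y : Fin m} :
    (Tuple.sort f).symm x ≤ (Tuple.sort f).symm y ↔ f x ≤ f y := by
  constructor
  · intro h
    rcases h.lt_or_eq with h | h
    · exact symm_sort_lt h
    · rw [(Tuple.sort f).symm.injective h]
  · intro h
    by_contra hlt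
    have := symm_sort_lt (not_le.1 hlt)
    exact hlt (by rw [hf (le_antisymm h this)])

theorem symm_sort_lt_iff {m : ℕ} {f : Fin m → ℤ} (hf : Function.Injective f) {x y : Fin m} :
    (Tuple.sort f).symm x < (Tuple.sort f).symm y ↔ f x < f y := by
  simp only [← not_le, symm_sort_le_iff hf]

end Keys

/-! ### Southwest ranks with arbitrary thresholds -/

section BlockRanks

variable {k : Type*} [Field k] {n : ℕ} {d : Fin (n + 1) → ℕ}

theorem subRank_eq_zero_iff {m n : Type*} [Fintype n] (M : Matrix m n k) (p : m → Prop)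
    (q : n → Prop) : subRank M p q = 0 ↔ ∀ i j, p i → q j → M i j = 0 := by
  classical
  unfold subRank
  rw [Matrix.rank, Submodule.finrank_eq_zero, LinearMap.range_eq_bot]
  constructor
  · intro h i j hi hj
    have := congrFun (LinearMap.congr_fun h (Pi.single ⟨j, hj⟩ 1)) ⟨i, hi⟩
    simpa using this
  · intro h
    have h0 : M.submatrix (fun i : {i // p i} => i.1) (fun j : {j // q j} => j.1) = 0 := by
      ext i j
      exact h _ _ i.2 j.2
    rw [h0, Matrix.mulVecLin_zero]

/-- The matrix, indexed by the elements of all the blocks, with the `([x],[y])`-blocks `F x y`. -/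
def total (F : ∀ x y : Fin (n + 1), Matrix (Fin (d x)) (Fin (d y)) k) :
    Matrix (Σ x, Fin (d x)) (Σ x, Fin (d x)) k :=
  Matrix.of fun p q => F p.1 q.1 p.2 q.2

/-- The rank of the part of a blocked matrix with the block rows of `key₁` at least `c` and the
block columns of `key₂` at most `i`. -/
noncomputable def blockRank (o : Fin n → Bool)
    (F : ∀ x y : Fin (n + 1), Matrix (Fin (d x)) (Fin (d y)) k) (c i : ℤ) : ℕ :=
  subRank (total F) (fun p => c ≤ key₁ o p.1) (fun q => key₂ o q.1 ≤ i)

theorem swRank_blocked (o : Fin n → Bool)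
    (F : ∀ x y : Fin (n + 1), Matrix (Fin (d x)) (Fin (d y)) k) (x y : Fin (n + 1)) :
    swRank (seq₁ o) (seq₂ o) (blocked (seq₁ o) (seq₂ o) F) x y =
      blockRank o F (key₁ o x) (key₂ o y) := by
  rw [swRank_eq_subRank, blockRank, ← subRank_submatrix_equiv (total F) (index d (seq₁ o))
    (index d (seq₂ o))]
  simp only [pos, seq₁, seq₂, symm_sort_le_iff (key₁_injective o),
    symm_sort_le_iff (key₂_injective o)]
  rfl

theorem exists_le_iff_key {m : ℕ} (f : Fin m → ℤ) (c : ℤ) :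
    (∀ x, ¬ c ≤ f x) ∨ ∃ x₀, ∀ x, c ≤ f x ↔ f x₀ ≤ f x := by
  classical
  by_cases h : ∃ x, c ≤ f x
  · obtain ⟨x₀, h0, hmin⟩ := Finset.exists_min_image (Finset.univ.filter fun x => c ≤ f x) f
      (by obtain ⟨x, hx⟩ := h; exact ⟨x, by simpa using hx⟩)
    simp only [Finset.mem_filter, Finset.mem_univ, true_and] at h0 hmin
    exact Or.inr ⟨x₀, fun x => ⟨hmin x, h0.trans⟩⟩
  · exact Or.inl (not_exists.1 h)

/-- A threshold either excludes all vertices, so that the rank is `0`, or can be moved to the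
nearest key that occurs. Arbitrary integer thresholds are convenient later, where they need not be
keys. -/
theorem blockRank_eq_of_swRank_eq {o : Fin n → Bool}
    {F G : ∀ x y : Fin (n + 1), Matrix (Fin (d x)) (Fin (d y)) k}
    (h : ∀ x y, swRank (seq₁ o) (seq₂ o) (blocked (seq₁ o) (seq₂ o) F) x y =
      swRank (seq₁ o) (seq₂ o) (blocked (seq₁ o) (seq₂ o) G) x y) (c i : ℤ) :
    blockRank o F c i = blockRank o G c i := by
  classical
  simp only [swRank_blocked] at h
  rcases exists_le_iff_key (key₁ o) c with hc | ⟨x₀, hx⟩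
  · have hz : ∀ H : ∀ x y : Fin (n + 1), Matrix (Fin (d x)) (Fin (d y)) k,
        blockRank o H c i = 0 := by
      intro H
      exact (subRank_eq_zero_iff _ _ _).2 fun p q hp _ => absurd hp (hc _)
    rw [hz, hz]
  rcases exists_le_iff_key (fun y => -key₂ o y) (-i) with hi | ⟨y₀, hy⟩
  · have hz : ∀ H : ∀ x y : Fin (n + 1), Matrix (Fin (d x)) (Fin (d y)) k,
        blockRank o H c i = 0 := by
      intro H
      exact (subRank_eq_zero_iff _ _ _).2 fun p q _ hq => absurd (neg_le_neg hq) (hi _)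
    rw [hz, hz]
  simp only [neg_le_neg_iff] at hy
  have := h x₀ y₀
  simpa only [blockRank, ← hx, ← hy] using this

end BlockRanks

/-! ### Ranks as dimensions of null spaces -/

section Operators

variable {k : Type*} [Field k] {n : ℕ} {o : Fin n → Bool} {d : Fin (n + 1) → ℕ}

/-- The space `⨁ₓ k ^ d x`. -/
abbrev Vec (k : Type*) [Field k] {n : ℕ} (d : Fin (n + 1) → ℕ) : Type _ :=
  ∀ x : Fin (n + 1), Fin (d x) → k

/-- The map of `V` on the edge `i` if this is a right arrow, and `0` otherwise. -/
def rightStep (V : Rep k o d) (i : Fin n) :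
    (Fin (d i.castSucc) → k) →ₗ[k] (Fin (d i.succ) → k) :=
  if h : o i = true then (V.B i h).mulVecLin else 0

/-- The map of `V` on the edge `i` if this is a left arrow, and `0` otherwise. -/
def leftStep (V : Rep k o d) (i : Fin n) :
    (Fin (d i.succ) → k) →ₗ[k] (Fin (d i.castSucc) → k) :=
  if h : o i = false then (V.A i h).mulVecLin else 0

/-- The sum of the maps of `V` on the right arrows. -/
def rightLin (V : Rep k o d) : Vec k d →ₗ[k] Vec k d :=
  LinearMap.pi (Fin.cases 0 fun i => rightStep V i ∘ₗ LinearMap.proj i.castSucc)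

/-- The sum of the maps of `V` on the left arrows. -/
def leftLin (V : Rep k o d) : Vec k d →ₗ[k] Vec k d :=
  LinearMap.pi (Fin.lastCases 0 fun i => leftStep V i ∘ₗ LinearMap.proj i.succ)

@[simp] theorem rightLin_zero (V : Rep k o d) (w : Vec k d) : rightLin V w 0 = 0 := rfl

@[simp] theorem rightLin_succ (V : Rep k o d) (w : Vec k d) (i : Fin n) :
    rightLin V w i.succ = rightStep V i (w i.castSucc) := rfl

@[simp] theorem leftLin_last (V : Rep k o d) (w : Vec k d) : leftLin V w (Fin.last n) = 0 := by
  simp [leftLin]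

@[simp] theorem leftLin_castSucc (V : Rep k o d) (w : Vec k d) (i : Fin n) :
    leftLin V w i.castSucc = leftStep V i (w i.succ) := by
  simp [leftLin]

/-- The endomorphism of `⨁ₓ k ^ d x` with the components `F x y`. -/
def blockLin (F : ∀ x y : Fin (n + 1), Matrix (Fin (d x)) (Fin (d y)) k) :
    Vec k d →ₗ[k] Vec k d :=
  LinearMap.pi fun x => ∑ y, (F x y).mulVecLin ∘ₗ LinearMap.proj y

theorem blockLin_apply (F : ∀ x y : Fin (n + 1), Matrix (Fin (d x)) (Fin (d y)) k)
    (w : Vec k d) (x : Fin (n + 1)) : blockLin F w x = ∑ y, (F x y).mulVec (w y) := by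
  simp [blockLin]

theorem blockLin_injective {F G : ∀ x y : Fin (n + 1), Matrix (Fin (d x)) (Fin (d y)) k}
    (h : blockLin F = blockLin G) : F = G := by
  have key : ∀ (F : ∀ x y : Fin (n + 1), Matrix (Fin (d x)) (Fin (d y)) k) (x y)
      (v : Fin (d y) → k), blockLin F (Pi.single y v) x = (F x y).mulVec v := by
    intro F x y v
    rw [blockLin_apply, Finset.sum_eq_single y]
    · rw [Pi.single_eq_same]
    · intro z _ hz
      rw [Pi.single_eq_of_ne hz, Matrix.mulVec_zero]
    · simp
  funext x y
  refine Matrix.ext_of_mulVec_single fun j => ?_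
  rw [← key, ← key, h]

/-- The vectors `w` such that `Q w` vanishes on the vertices of `key₂` greater than `i`, and `P w`
on the vertices of `key₁` at least `c`. -/
def nullSpace (o : Fin n → Bool) (Q P : Vec k d →ₗ[k] Vec k d) (c i : ℤ) :
    Submodule k (Vec k d) where
  carrier := {w | (∀ x, i < key₂ o x → Q w x = 0) ∧ ∀ x, c ≤ key₁ o x → P w x = 0}
  zero_mem' := by simp
  add_mem' := by
    rintro a b ⟨h1, h2⟩ ⟨h3, h4⟩
    exact ⟨fun x hx => by simp [h1 x hx, h3 x hx], fun x hx => by simp [h2 x hx, h4 x hx]⟩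
  smul_mem' := by
    rintro a b ⟨h1, h2⟩
    exact ⟨fun x hx => by simp [h1 x hx], fun x hx => by simp [h2 x hx]⟩

/-- Rank-nullity for the southwest submatrix of `F = PQ⁻¹`: the bijection `Q` carries the null space
onto the kernel of that submatrix, extended by zero to the remaining columns. -/
theorem finrank_nullSpace_add_blockRank {Q P : Vec k d →ₗ[k] Vec k d}
    {F : ∀ x y : Fin (n + 1), Matrix (Fin (d x)) (Fin (d y)) k} (hQ : Function.Injective Q)
    (h : ∀ w, blockLin F (Q w) = P w) (c i : ℤ) :
    Module.finrank k (nullSpace o Q P c i) + blockRank o F c i =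
      Nat.card {q : Σ x, Fin (d x) // key₂ o q.1 ≤ i} := by
  classical
  let N := (total F).submatrix
    (fun p : {p : Σ x, Fin (d x) // c ≤ key₁ o p.1} => p.1)
    (fun q : {q : Σ x, Fin (d x) // key₂ o q.1 ≤ i} => q.1)
  have hrn := LinearMap.finrank_range_add_finrank_ker N.mulVecLin
  have hN : Module.finrank k (LinearMap.range N.mulVecLin) = blockRank o F c i := by
    unfold blockRank subRank Matrix.rank
    congr!
  rw [Module.finrank_fintype_fun_eq_card, hN] at hrn
  rw [Nat.card_eq_fintype_card, add_comm, ← hrn]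
  congr 1
  have hsum : ∀ w, (∀ x, i < key₂ o x → Q w x = 0) →
      ∀ p : {p : Σ x, Fin (d x) // c ≤ key₁ o p.1},
        N.mulVec (fun q => Q w q.1.1 q.1.2) p = P w p.1.1 p.1.2 := by
    intro w hw p
    have h1 : P w p.1.1 p.1.2 = ∑ q : Σ x, Fin (d x), F p.1.1 q.1 p.1.2 q.2 * Q w q.1 q.2 := by
      rw [← h, blockLin_apply, Finset.sum_apply, Fintype.sum_sigma]
      rfl
    rw [h1, ← Fintype.sum_subtype_add_sum_subtype fun q : Σ x, Fin (d x) => key₂ o q.1 ≤ i]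
    refine (add_eq_left.2 (Finset.sum_eq_zero fun q _ => ?_)).symm
    rw [hw _ (not_le.1 q.2), Pi.zero_apply, mul_zero]
  let f : nullSpace o Q P c i →ₗ[k] LinearMap.ker N.mulVecLin :=
    { toFun := fun w => ⟨fun q => Q w.1 q.1.1 q.1.2, by
        rw [LinearMap.mem_ker]
        ext p
        rw [Matrix.mulVecLin_apply, hsum w.1 w.2.1, w.2.2 _ p.2]
        rfl⟩
      map_add' := fun a b => by ext; simp
      map_smul' := fun a b => by ext; simp }
  refine (LinearEquiv.ofBijective f ⟨?_, ?_⟩).finrank_eq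
  · intro a b hab
    refine Subtype.ext (hQ ?_)
    funext x s
    by_cases hx : key₂ o x ≤ i
    · exact congrFun (congrArg Subtype.val hab) ⟨⟨x, s⟩, hx⟩
    · rw [a.2.1 x (not_le.1 hx), b.2.1 x (not_le.1 hx)]
  · rintro ⟨v, hv⟩
    have hsurj := LinearMap.surjective_of_injective hQ
    obtain ⟨w, hw⟩ := hsurj fun x s => if hx : key₂ o x ≤ i then v ⟨⟨x, s⟩, hx⟩ else 0
    have hw1 : ∀ x, i < key₂ o x → Q w x = 0 := by
      intro x hx
      rw [hw]
      funext s
      exact dif_neg (not_le.2 hx)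
    have hwv : (fun q : {q : Σ x, Fin (d x) // key₂ o q.1 ≤ i} => Q w q.1.1 q.1.2) = v := by
      funext q
      rw [hw]
      exact dif_pos q.2
    refine ⟨⟨w, hw1, fun x hx => ?_⟩, Subtype.ext hwv⟩
    funext s
    rw [← hsum w hw1 ⟨⟨x, s⟩, hx⟩, hwv]
    exact congrFun (LinearMap.mem_ker.1 hv) _

end Operators

/-! ### The factorization of the Zelevinsky matrix -/

section ZetaOperators

variable {k : Type*} [Field k] {n : ℕ} {o : Fin n → Bool} {d : Fin (n + 1) → ℕ}

/-- `1 - B`, where `B` is the sum of the maps on the right arrows. -/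
def oneSubRight (V : Rep k o d) : Vec k d →ₗ[k] Vec k d := LinearMap.id - rightLin V

/-- `1 + A`, where `A` is the sum of the maps on the left arrows. -/
def oneAddLeft (V : Rep k o d) : Vec k d →ₗ[k] Vec k d := LinearMap.id + leftLin V

theorem oneSubRight_zero (V : Rep k o d) (w : Vec k d) : oneSubRight V w 0 = w 0 := by
  simp [oneSubRight]

theorem oneSubRight_succ (V : Rep k o d) (w : Vec k d) (i : Fin n) :
    oneSubRight V w i.succ = w i.succ - rightStep V i (w i.castSucc) := by
  simp [oneSubRight]

theorem oneAddLeft_last (V : Rep k o d) (w : Vec k d) :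
    oneAddLeft V w (Fin.last n) = w (Fin.last n) := by
  simp [oneAddLeft]

theorem oneAddLeft_castSucc (V : Rep k o d) (w : Vec k d) (i : Fin n) :
    oneAddLeft V w i.castSucc = w i.castSucc + leftStep V i (w i.succ) := by
  simp [oneAddLeft]

theorem rightStep_of_false (V : Rep k o d) {i : Fin n} (h : o i = false) : rightStep V i = 0 := by
  simp [rightStep, h]

theorem leftStep_of_true (V : Rep k o d) {i : Fin n} (h : o i = true) : leftStep V i = 0 := by
  simp [leftStep, h]

theorem oneSubRight_injective (V : Rep k o d) : Function.Injective (oneSubRight V) := by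
  rw [injective_iff_map_eq_zero]
  intro w hw
  funext x
  induction x using Fin.induction with
  | zero => rw [← oneSubRight_zero V w, hw]
  | succ i ih =>
    have := congrFun hw i.succ
    rw [oneSubRight_succ, ih] at this
    simpa using this

/-- `1 + A` is upper unitriangular for the natural order of the vertices, so one can solve from the
rightmost vertex down to `m`. -/
theorem eq_zero_of_oneAddLeft_eq_zero (V : Rep k o d) {w : Vec k d} {m : ℕ}
    (h : ∀ x : Fin (n + 1), m ≤ x → oneAddLeft V w x = 0) (x : Fin (n + 1)) (hx : m ≤ x) :
    w x = 0 := by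
  induction x using Fin.reverseInduction with
  | last => rw [← oneAddLeft_last V w, h _ hx]
  | cast i ih =>
    have := h _ hx
    rw [oneAddLeft_castSucc, ih (by simp at hx ⊢; omega)] at this
    simpa using this

theorem oneAddLeft_injective (V : Rep k o d) : Function.Injective (oneAddLeft V) := by
  rw [injective_iff_map_eq_zero]
  intro w hw
  funext x
  exact eq_zero_of_oneAddLeft_eq_zero V (m := 0) (fun x _ => by rw [hw]; rfl) x (Nat.zero_le _)

theorem rightMap_mulVec_succ (V : Rep k o d) {y : Fin (n + 1)} {i : Fin n} (hy : y ≠ i.succ)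
    (v : Fin (d y) → k) :
    (rightMap V y i.succ).mulVec v = rightStep V i ((rightMap V y i.castSucc).mulVec v) := by
  have hR : rightMap V y i.succ =
      if h : o i = true then V.B i h * rightMap V y i.castSucc else 0 := by
    simp [rightMap, hy]
  rw [hR, rightStep]
  split_ifs <;> simp

theorem rightMap_eq_zero (V : Rep k o d) {x y : Fin (n + 1)} (h : x < y) : rightMap V y x = 0 := by
  induction x using Fin.induction with
  | zero => simp [rightMap, h.ne']
  | succ i ih =>
    have hlt : i.castSucc < y := (Fin.castSucc_lt_succ).trans h
    refine Matrix.ext_of_mulVec_single fun j => ?_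
    rw [rightMap_mulVec_succ V h.ne', ih hlt, Matrix.zero_mulVec, Matrix.zero_mulVec, map_zero]

theorem leftMap_mulVec_succ (V : Rep k o d) (i : Fin n) (v : Fin (d i.succ) → k) :
    (leftMap V i.castSucc i.succ).mulVec v = leftStep V i v := by
  have h1 : leftMap V i.castSucc i.castSucc = 1 := by
    have h : idBlock k (d i.castSucc) (d i.castSucc) = 1 := by
      ext a b
      simp [idBlock, Matrix.one_apply, Fin.ext_iff]
    generalize i.castSucc = x at h
    cases x using Fin.cases with
    | zero => simpa [leftMap] using h
    | succ i => simpa [leftMap] using h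
  have hL : leftMap V i.castSucc i.succ =
      if h : o i = false then leftMap V i.castSucc i.castSucc * V.A i h else 0 := by
    simp [leftMap, (Fin.castSucc_lt_succ (i := i)).ne]
  rw [hL, h1, leftStep]
  split_ifs <;> simp

theorem sum_rightMap_zero (V : Rep k o d) (w : Vec k d) :
    ∑ y, (rightMap V y 0).mulVec (w y) = w 0 := by
  rw [Fintype.sum_eq_single 0, rightMap_self, Matrix.one_mulVec]
  intro y hy
  rw [rightMap_eq_zero V (Fin.pos_of_ne_zero hy), Matrix.zero_mulVec]

theorem sum_rightMap_succ (V : Rep k o d) (w : Vec k d) (i : Fin n) :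
    ∑ y, (rightMap V y i.succ).mulVec (w y) =
      w i.succ + rightStep V i (∑ y, (rightMap V y i.castSucc).mulVec (w y)) := by
  rw [map_sum, ← Finset.add_sum_erase _ _ (Finset.mem_univ i.succ), rightMap_self,
    Matrix.one_mulVec, ← Finset.add_sum_erase _ (fun y => rightStep V i _)
      (Finset.mem_univ i.succ), rightMap_eq_zero V Fin.castSucc_lt_succ, Matrix.zero_mulVec,
    map_zero, zero_add]
  refine congrArg _ (Finset.sum_congr rfl fun y hy => ?_)
  rw [rightMap_mulVec_succ V (Finset.ne_of_mem_erase hy)]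

/-- The path maps to the right are the blocks of the geometric series `(1 - B)⁻¹`. -/
theorem sum_rightMap_oneSubRight (V : Rep k o d) (w : Vec k d) (x : Fin (n + 1)) :
    ∑ y, (rightMap V y x).mulVec (oneSubRight V w y) = w x := by
  induction x using Fin.induction with
  | zero => rw [sum_rightMap_zero, oneSubRight_zero]
  | succ i ih => rw [sum_rightMap_succ, ih, oneSubRight_succ, sub_add_cancel]

theorem zetaBlock_of_ne (V : Rep k o d) {x y : Fin (n + 1)} (h : (y : ℕ) ≠ x + 1) :
    zetaBlock V x y = rightMap V y x := by
  unfold zetaBlock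
  split_ifs with h1
  · rfl
  · rw [rightMap_eq_zero V (not_le.1 h1)]

theorem blockLin_zetaBlock (V : Rep k o d) (w : Vec k d) (x : Fin (n + 1)) :
    blockLin (zetaBlock V) w x = ∑ y, (rightMap V y x).mulVec (w y) + leftLin V w x := by
  rw [blockLin_apply]
  cases x using Fin.lastCases with
  | last =>
    rw [leftLin_last, add_zero]
    refine Finset.sum_congr rfl fun y _ => ?_
    rw [zetaBlock_of_ne]
    have := y.2
    simp
    omega
  | cast i =>
    rw [← Finset.sum_erase_add _ _ (Finset.mem_univ i.succ),
      ← Finset.sum_erase_add _ (fun y => (rightMap V y i.castSucc).mulVec (w y))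
        (Finset.mem_univ i.succ), rightMap_eq_zero V Fin.castSucc_lt_succ, Matrix.zero_mulVec,
      add_zero, leftLin_castSucc, ← leftMap_mulVec_succ]
    congr 1
    · refine Finset.sum_congr rfl fun y hy => ?_
      rw [zetaBlock_of_ne]
      intro h
      exact Finset.ne_of_mem_erase hy (by ext; simpa using h)
    · unfold zetaBlock
      rw [if_neg (not_le.2 Fin.castSucc_lt_succ), if_pos (by simp)]

/-- In `AB` a component would have to traverse the same edge to the right and back to the left. With
`AB = 0`, `(1 - B)⁻¹ + A` equals `(1 + A)(1 - B)⁻¹`. -/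
theorem leftLin_rightLin (V : Rep k o d) (w : Vec k d) : leftLin V (rightLin V w) = 0 := by
  funext x
  cases x using Fin.lastCases with
  | last => rw [leftLin_last]; rfl
  | cast i =>
    rw [leftLin_castSucc, rightLin_succ]
    rcases h : o i with _ | _
    · simp [rightStep_of_false V h]
    · simp [leftStep_of_true V h]

/-- The Zelevinsky matrix is `(1 + A)(1 - B)⁻¹`. -/
theorem blockLin_zetaBlock_oneSubRight (V : Rep k o d) (w : Vec k d) :
    blockLin (zetaBlock V) (oneSubRight V w) = oneAddLeft V w := by
  funext x
  rw [blockLin_zetaBlock, sum_rightMap_oneSubRight, oneSubRight, LinearMap.sub_apply, map_sub,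
    leftLin_rightLin, sub_zero]
  rfl

theorem eq_zetaBlock (V : Rep k o d) {F : ∀ x y : Fin (n + 1), Matrix (Fin (d x)) (Fin (d y)) k}
    (h : ∀ w, blockLin F (oneSubRight V w) = oneAddLeft V w) : F = zetaBlock V := by
  refine blockLin_injective (LinearMap.ext fun u => ?_)
  obtain ⟨w, rfl⟩ := LinearMap.surjective_of_injective (oneSubRight_injective V) u
  rw [h, blockLin_zetaBlock_oneSubRight]

theorem finrank_nullSpace_add_zeta (V : Rep k o d) (c i : ℤ) :
    Module.finrank k (nullSpace o (oneSubRight V) (oneAddLeft V) c i) +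
      blockRank o (zetaBlock V) c i = Nat.card {q : Σ x, Fin (d x) // key₂ o q.1 ≤ i} :=
  finrank_nullSpace_add_blockRank (oneSubRight_injective V) (blockLin_zetaBlock_oneSubRight V) c i

end ZetaOperators

/-! ### Matrices with the ranks of a Zelevinsky matrix -/

section Image

variable {k : Type*} [Field k] {n : ℕ} {o : Fin n → Bool} {d : Fin (n + 1) → ℕ}

/-- The blocks of an element of the affine space `𝔸_Q`. -/
structure IsCellBlocks (o : Fin n → Bool)
    (F : ∀ x y : Fin (n + 1), Matrix (Fin (d x)) (Fin (d y)) k) : Prop where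
  diag : ∀ x, F x x = 1
  eq_zero : ∀ x y, key₂ o x < key₂ o y ∨ key₁ o x < key₁ o y → F x y = 0

variable {F : ∀ x y : Fin (n + 1), Matrix (Fin (d x)) (Fin (d y)) k}

/-- This and the next three lemmas find the possible off-diagonal blocks: below the diagonal only
from left ends to right ends of right arrows, above it only from columns that are not such right
ends to rows that are not such left ends. -/
theorem IsCellBlocks.lower_eq_zero_of_not_startsRight (hF : IsCellBlocks o F) {x y : Fin (n + 1)}
    (hxy : y < x) (h : ¬ StartsRight o y) : F x y = 0 := by
  refine hF.eq_zero _ _ (Or.inr ?_)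
  have : (y : ℕ) < x := hxy
  rw [key₁_of_not_startsRight h]
  unfold key₁
  split_ifs <;> omega

theorem IsCellBlocks.lower_eq_zero_of_not_endsRight (hF : IsCellBlocks o F) {x y : Fin (n + 1)}
    (hxy : y < x) (h : ¬ EndsRight o x) : F x y = 0 := by
  refine hF.eq_zero _ _ (Or.inl ?_)
  have : (y : ℕ) < x := hxy
  rw [key₂_of_not_endsRight h]
  unfold key₂
  split_ifs <;> omega

theorem IsCellBlocks.upper_eq_zero_of_startsRight (hF : IsCellBlocks o F) {x y : Fin (n + 1)}
    (hxy : x < y) (h : StartsRight o x) : F x y = 0 := by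
  refine hF.eq_zero _ _ (Or.inr ?_)
  have : (x : ℕ) < y := hxy
  rw [key₁_of_startsRight h]
  unfold key₁
  split_ifs <;> omega

theorem IsCellBlocks.upper_eq_zero_of_endsRight (hF : IsCellBlocks o F) {x y : Fin (n + 1)}
    (hxy : x < y) (h : EndsRight o y) : F x y = 0 := by
  refine hF.eq_zero _ _ (Or.inl ?_)
  have : (x : ℕ) < y := hxy
  rw [key₂_of_endsRight h]
  unfold key₂
  split_ifs <;> omega

/-- In the remaining case the southwest region of `([x],[y])` contains only blocks `([p],[q])` with
`p ≤ x` and `y ≤ q`. These are beyond the superdiagonal, where a Zelevinsky matrix vanishes, so the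
rank there is `0`. -/
theorem upper_eq_zero_of_blockRank_eq (hF : IsCellBlocks o F) (V₀ : Rep k o d)
    (hr : ∀ c i, blockRank o F c i = blockRank o (zetaBlock V₀) c i) {x y : Fin (n + 1)}
    (hxy : (x : ℕ) + 1 < y) : F x y = 0 := by
  have hlt : x < y := Fin.lt_def.2 (by omega)
  by_cases hx : StartsRight o x
  · exact hF.upper_eq_zero_of_startsRight hlt hx
  by_cases hy : EndsRight o y
  · exact hF.upper_eq_zero_of_endsRight hlt hy
  have h0 : blockRank o (zetaBlock V₀) (key₁ o x) (key₂ o y) = 0 := by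
    refine (subRank_eq_zero_iff _ _ _).2 fun p q hp hq => ?_
    have hz : zetaBlock V₀ p.1 q.1 = 0 := by
      rw [key₁_of_not_startsRight hx] at hp
      rw [key₂_of_not_endsRight hy] at hq
      have hpx : (p.1 : ℕ) ≤ x := by
        unfold key₁ at hp
        have := p.1.2
        split_ifs at hp <;> omega
      have hqy : (y : ℕ) ≤ q.1 := by
        unfold key₂ at hq
        split_ifs at hq <;> omega
      rw [zetaBlock_of_ne V₀ (by omega), rightMap_eq_zero V₀ (Fin.lt_def.2 (by omega))]
    change zetaBlock V₀ p.1 q.1 p.2 q.2 = 0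
    rw [hz]
    rfl
  rw [← hr] at h0
  ext s t
  exact (subRank_eq_zero_iff _ _ _).1 h0 ⟨x, s⟩ ⟨y, t⟩ le_rfl le_rfl

/-- The strictly lower triangular part of a blocked matrix. -/
def lowerLin (F : ∀ x y : Fin (n + 1), Matrix (Fin (d x)) (Fin (d y)) k) :
    Vec k d →ₗ[k] Vec k d :=
  blockLin fun x y => if y < x then F x y else 0

theorem lowerLin_apply (w : Vec k d) (x : Fin (n + 1)) :
    lowerLin F w x = ∑ y, if y < x then (F x y).mulVec (w y) else 0 := by
  rw [lowerLin, blockLin_apply]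
  refine Finset.sum_congr rfl fun y _ => ?_
  split_ifs <;> simp

theorem lowerLin_eq_zero_of_lt {w : Vec k d} {x : Fin (n + 1)} (h : ∀ y < x, w y = 0) :
    lowerLin F w x = 0 := by
  rw [lowerLin_apply]
  refine Finset.sum_eq_zero fun y _ => ?_
  split_ifs with hy
  · rw [h y hy, Matrix.mulVec_zero]
  · rfl

theorem eq_zero_of_lowerLin {w : Vec k d} {m : ℕ}
    (h : ∀ x : Fin (n + 1), (x : ℕ) < m → (w + lowerLin F w) x = 0) (x : Fin (n + 1))
    (hx : (x : ℕ) < m) : w x = 0 := by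
  induction x using WellFoundedLT.induction with
  | ind x ih =>
    have := h x hx
    rwa [Pi.add_apply, lowerLin_eq_zero_of_lt fun y hy => ih y hy (lt_trans hy hx),
      add_zero] at this

theorem IsCellBlocks.lowerLin_eq_zero (hF : IsCellBlocks o F) {w : Vec k d}
    (h : ∀ x, StartsRight o x → w x = 0) : lowerLin F w = 0 := by
  funext x
  rw [lowerLin_apply]
  refine Finset.sum_eq_zero fun y _ => ?_
  split_ifs with hy
  · by_cases hs : StartsRight o y
    · rw [h y hs, Matrix.mulVec_zero]
    · rw [hF.lower_eq_zero_of_not_startsRight hy hs, Matrix.zero_mulVec]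
  · rfl

theorem IsCellBlocks.lowerLin_apply_of_not_endsRight (hF : IsCellBlocks o F) (w : Vec k d)
    {x : Fin (n + 1)} (h : ¬ EndsRight o x) : lowerLin F w x = 0 := by
  rw [lowerLin_apply]
  refine Finset.sum_eq_zero fun y _ => ?_
  split_ifs with hy
  · rw [hF.lower_eq_zero_of_not_endsRight hy h, Matrix.zero_mulVec]
  · rfl

/-- `1 + L`, where `L` is the strictly lower triangular part. -/
noncomputable def oneAddLower (F : ∀ x y : Fin (n + 1), Matrix (Fin (d x)) (Fin (d y)) k) :
    Vec k d ≃ₗ[k] Vec k d :=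
  LinearEquiv.ofInjectiveEndo (LinearMap.id + lowerLin F) <| by
    rw [injective_iff_map_eq_zero]
    intro w hw
    funext x
    exact eq_zero_of_lowerLin (m := n + 1) (fun x _ => congrFun hw x) x x.2

theorem oneAddLower_symm_add (w : Vec k d) :
    (oneAddLower F).symm w + lowerLin F ((oneAddLower F).symm w) = w :=
  (oneAddLower F).apply_symm_apply w

theorem oneAddLower_symm_of_lowerLin_eq_zero {w : Vec k d} (h : lowerLin F w = 0) :
    (oneAddLower F).symm w = w := by
  rw [LinearEquiv.symm_apply_eq]
  change w = w + lowerLin F w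
  rw [h, add_zero]

theorem oneAddLower_symm_apply_eq_zero {w : Vec k d} {m : ℕ}
    (h : ∀ x : Fin (n + 1), (x : ℕ) < m → w x = 0) (x : Fin (n + 1)) (hx : (x : ℕ) < m) :
    (oneAddLower F).symm w x = 0 :=
  eq_zero_of_lowerLin (F := F) (m := m)
    (fun x hx => by rw [oneAddLower_symm_add, h x hx]) x hx

/-- `1 - (1 + L)⁻¹`. -/
noncomputable def rightPart (F : ∀ x y : Fin (n + 1), Matrix (Fin (d x)) (Fin (d y)) k) :
    Vec k d →ₗ[k] Vec k d :=
  lowerLin F ∘ₗ (oneAddLower F).symm.toLinearMap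

theorem rightPart_apply (w : Vec k d) :
    rightPart F w = lowerLin F ((oneAddLower F).symm w) := rfl

theorem oneAddLower_symm_eq (w : Vec k d) : (oneAddLower F).symm w = w - rightPart F w :=
  eq_sub_of_add_eq (oneAddLower_symm_add w)

/-- The representation whose Zelevinsky matrix can have the blocks `F`. -/
noncomputable def ofBlocks (o : Fin n → Bool)
    (F : ∀ x y : Fin (n + 1), Matrix (Fin (d x)) (Fin (d y)) k) : Rep k o d where
  -- The subdiagonal block of `R = 1 - (1 + L)⁻¹`.
  B i _ := LinearMap.toMatrix'
    (LinearMap.proj i.succ ∘ₗ rightPart F ∘ₗ LinearMap.single k (fun x => Fin (d x) → k) i.castSucc)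
  A i _ := F i.castSucc i.succ

/-- This is `M = 1 + L + A`: the superdiagonal block at a right arrow vanishes by the shape of
`𝔸_Q`. -/
theorem blockLin_eq (hF : IsCellBlocks o F)
    (hU : ∀ x y : Fin (n + 1), (x : ℕ) + 1 < y → F x y = 0) (w : Vec k d) :
    blockLin F w = w + lowerLin F w + leftLin (ofBlocks o F) w := by
  funext x
  have hdiff : blockLin F w x - lowerLin F w x =
      ∑ y, if y < x then 0 else (F x y).mulVec (w y) := by
    rw [blockLin_apply, lowerLin_apply, ← Finset.sum_sub_distrib]
    refine Finset.sum_congr rfl fun y _ => ?_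
    split_ifs <;> simp
  suffices h : (∑ y, if y < x then 0 else (F x y).mulVec (w y)) =
      w x + leftLin (ofBlocks o F) w x by
    rw [h, sub_eq_iff_eq_add] at hdiff
    rw [hdiff, Pi.add_apply, Pi.add_apply]
    abel
  cases x using Fin.lastCases with
  | last =>
    rw [Fintype.sum_eq_single (Fin.last n), if_neg (lt_irrefl _), hF.diag, Matrix.one_mulVec,
      leftLin_last, add_zero]
    intro y hy
    rw [if_pos (Fin.lt_last_iff_ne_last.2 hy)]
  | cast i =>
    rw [Fintype.sum_eq_add i.castSucc i.succ (Fin.castSucc_lt_succ).ne, if_neg (lt_irrefl _),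
      hF.diag, Matrix.one_mulVec, if_neg (not_lt.2 (Fin.castSucc_lt_succ).le), leftLin_castSucc]
    · congr 1
      rcases h : o i with _ | _
      · simp [leftStep, h, ofBlocks]
      · rw [leftStep_of_true _ h, hF.upper_eq_zero_of_endsRight Fin.castSucc_lt_succ
          (endsRight_succ.2 h), Matrix.zero_mulVec]
        rfl
    · rintro y ⟨h1, h2⟩
      split_ifs with h
      · rfl
      · have h3 : (y : ℕ) ≠ i := fun h => h1 (by ext; simpa using h)
        have h4 : (y : ℕ) ≠ i + 1 := fun h => h2 (by ext; simpa using h)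
        have h5 : ¬ (y : ℕ) < i := fun h' => h (Fin.lt_def.2 (by simpa using h'))
        rw [hU _ _ (by simp; omega), Matrix.zero_mulVec]

/-- `AL = 0`: the image of `L` lives at right ends of right arrows, where no left arrow of the same
edge starts. The next lemma, `LA = 0`, is the dual statement about left ends. -/
theorem leftLin_lowerLin (hF : IsCellBlocks o F) (V : Rep k o d) (w : Vec k d) :
    leftLin V (lowerLin F w) = 0 := by
  funext x
  cases x using Fin.lastCases with
  | last => rw [leftLin_last]; rfl
  | cast i =>
    rw [leftLin_castSucc]
    rcases h : o i with _ | _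
    · rw [hF.lowerLin_apply_of_not_endsRight, map_zero]
      · rfl
      · rw [endsRight_succ, h]
        simp
    · rw [leftStep_of_true V h]
      rfl

theorem lowerLin_leftLin (hF : IsCellBlocks o F) (V : Rep k o d) (w : Vec k d) :
    lowerLin F (leftLin V w) = 0 := by
  refine hF.lowerLin_eq_zero fun x hx => ?_
  obtain ⟨i, rfl, h⟩ := hx
  rw [leftLin_castSucc, leftStep_of_true V h]
  rfl

/-- `(1 + L + A)(1 + L)⁻¹ = 1 + A(1 - R) = 1 + A`, because `R = L(1 + L)⁻¹` and `AL = 0`. -/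
theorem blockLin_oneAddLower_symm (hF : IsCellBlocks o F)
    (hU : ∀ x y : Fin (n + 1), (x : ℕ) + 1 < y → F x y = 0) (w : Vec k d) :
    blockLin F ((oneAddLower F).symm w) = oneAddLeft (ofBlocks o F) w := by
  rw [blockLin_eq hF hU, oneAddLower_symm_add, oneAddLower_symm_eq, map_sub, rightPart_apply,
    leftLin_lowerLin hF, sub_zero]
  rfl

/-- Here the rank conditions force `R` to be concentrated on the first subdiagonal. For `V₀`,
vanishing of `(1 + A)w` to the right of `y` kills `w` there, hence `(1 - B)w` from `y + 2` on, so
imposing its vanishing on columns of key at least `x` costs no dimension. Equality of ranks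
transfers this to `1 - R`. -/
theorem rightPart_single_eq_zero (hF : IsCellBlocks o F) (V₀ : Rep k o d)
    (hr : ∀ c i, blockRank o F c i = blockRank o (zetaBlock V₀) c i) {x y : Fin (n + 1)}
    (hxy : (y : ℕ) + 1 < x) (v : Fin (d y) → k) : rightPart F (Pi.single y v) x = 0 := by
  by_cases hy : StartsRight o y
  swap
  · have h0 : lowerLin F (Pi.single y v) = 0 := by
      refine hF.lowerLin_eq_zero fun z hz => ?_
      rw [Pi.single_eq_of_ne]
      rintro rfl
      exact hy hz
    rw [rightPart_apply, oneAddLower_symm_of_lowerLin_eq_zero h0, h0]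
    rfl
  by_cases hx : EndsRight o x
  swap
  · exact hF.lowerLin_apply_of_not_endsRight _ hx
  have hyn := hy.lt
  have hU := fun x y => upper_eq_zero_of_blockRank_eq (x := x) (y := y) hF V₀ hr
  set V := ofBlocks o F
  set Q : Vec k d →ₗ[k] Vec k d := (oneAddLower F).symm.toLinearMap
  have hQ : ∀ c i, Module.finrank k (nullSpace o Q (oneAddLeft V) c i) =
      Module.finrank k (nullSpace o (oneSubRight V₀) (oneAddLeft V₀) c i) := by
    intro c i
    have h1 := finrank_nullSpace_add_zeta V₀ c i
    rw [← finrank_nullSpace_add_blockRank (Q := Q) (P := oneAddLeft V)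
      (oneAddLower F).symm.injective (blockLin_oneAddLower_symm hF hU) c i, hr] at h1
    omega
  -- The rows of key at least `c` include every vertex to the right of `y` but not `y` itself, whose
  -- key is `c - 1`.
  set c : ℤ := (y : ℕ) + 1 - n
  have h0 : nullSpace o (oneSubRight V₀) (oneAddLeft V₀) c n ≤
      nullSpace o (oneSubRight V₀) (oneAddLeft V₀) c ((x : ℕ) - 1) := by
    rintro w ⟨-, hw⟩
    refine ⟨fun z hz => ?_, hw⟩
    have hwz : ∀ z : Fin (n + 1), (y : ℕ) + 1 ≤ z → w z = 0 := by
      refine eq_zero_of_oneAddLeft_eq_zero V₀ fun z hz => hw z ?_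
      have := z.2
      unfold key₁
      split_ifs <;> omega
    by_cases hzr : EndsRight o z
    · rw [key₂_of_endsRight hzr] at hz
      obtain ⟨j, rfl, _⟩ := hzr
      rw [Fin.val_succ] at hz
      rw [oneSubRight_succ, hwz j.succ (by simp; omega), hwz j.castSucc (by simp; omega)]
      simp
    · rw [key₂_of_not_endsRight hzr] at hz
      omega
  have hle : nullSpace o Q (oneAddLeft V) c ((x : ℕ) - 1) ≤ nullSpace o Q (oneAddLeft V) c n := by
    rintro w ⟨-, hw⟩
    refine ⟨fun z hz => ?_, hw⟩
    have := z.2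
    unfold key₂ at hz
    split_ifs at hz <;> omega
  have heq := Submodule.eq_of_le_of_finrank_le hle (by
    rw [hQ, hQ]
    exact Submodule.finrank_mono h0)
  -- Testing on `w = (1 + A)⁻¹` of the vector at `y` is enough: `w` differs from that vector by
  -- `Aw`, which `R` kills, and `w` vanishes at `x`.
  obtain ⟨w, hw⟩ := LinearMap.surjective_of_injective (oneAddLeft_injective V) (Pi.single y v)
  have hmem : w ∈ nullSpace o Q (oneAddLeft V) c n := by
    refine ⟨fun z hz => ?_, fun z hz => ?_⟩
    · have := z.2
      unfold key₂ at hz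
      split_ifs at hz <;> omega
    · rw [hw, Pi.single_eq_of_ne]
      rintro rfl
      rw [key₁_of_startsRight hy] at hz
      omega
  rw [← heq] at hmem
  have hQx : (oneAddLower F).symm w x = 0 := hmem.1 x (by rw [key₂_of_endsRight hx]; omega)
  have hwx : w x = 0 := eq_zero_of_oneAddLeft_eq_zero V (m := (y : ℕ) + 1) (fun z hz => by
    rw [hw, Pi.single_eq_of_ne]
    rintro rfl
    omega) x hxy.le
  have hs : (Pi.single y v : Vec k d) = w + leftLin V w := hw.symm
  rw [oneAddLower_symm_eq, Pi.sub_apply, hwx, zero_sub, neg_eq_zero] at hQx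
  have hA := lowerLin_leftLin hF V w
  have hRA : rightPart F (leftLin V w) = 0 := by
    rw [rightPart_apply, oneAddLower_symm_of_lowerLin_eq_zero hA, hA]
  rw [hs, map_add, hRA, add_zero, hQx]

theorem rightPart_eq (hF : IsCellBlocks o F) (V₀ : Rep k o d)
    (hr : ∀ c i, blockRank o F c i = blockRank o (zetaBlock V₀) c i) (w : Vec k d) :
    rightPart F w = rightLin (ofBlocks o F) w := by
  funext x
  cases x using Fin.cases with
  | zero =>
    rw [rightLin_zero]
    exact hF.lowerLin_apply_of_not_endsRight _ (not_endsRight_zero o)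
  | succ i =>
    rw [rightLin_succ]
    rcases h : o i with _ | _
    · rw [rightStep_of_false _ h]
      exact hF.lowerLin_apply_of_not_endsRight _ (by rw [endsRight_succ, h]; simp)
    · have hw : w = ∑ y, Pi.single y (w y) := (Finset.univ_sum_single w).symm
      conv_lhs => rw [hw]
      rw [map_sum, Finset.sum_apply, Fintype.sum_eq_single i.castSucc]
      · simp only [rightStep, h, dif_pos, ofBlocks, Matrix.mulVecLin_apply,
          LinearMap.toMatrix'_mulVec]
        rfl
      · intro y hy
        have h1 : (y : ℕ) ≠ i := fun h => hy (by ext; simpa using h)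
        by_cases hlt : (y : ℕ) < i
        · exact rightPart_single_eq_zero hF V₀ hr (by simp; omega) _
        -- Here `y` is at least `i + 1`, and `R` is strictly lower triangular.
        · refine lowerLin_eq_zero_of_lt fun z hz => ?_
          refine oneAddLower_symm_apply_eq_zero (m := (y : ℕ)) (fun z hz => ?_) z ?_
          · exact Pi.single_eq_of_ne (by rintro rfl; exact lt_irrefl _ hz) _
          · have := Fin.lt_def.1 hz
            simp at this
            omega

/-- A point of the affine space `𝔸_Q` with the block ranks of a Zelevinsky matrix is a Zelevinsky
matrix. -/
theorem exists_eq_zetaBlock (hF : IsCellBlocks o F) (V₀ : Rep k o d)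
    (hr : ∀ c i, blockRank o F c i = blockRank o (zetaBlock V₀) c i) :
    ∃ V : Rep k o d, F = zetaBlock V := by
  refine ⟨ofBlocks o F, eq_zetaBlock _ fun w => ?_⟩
  rw [← blockLin_oneAddLower_symm hF
    (fun x y => upper_eq_zero_of_blockRank_eq (x := x) (y := y) hF V₀ hr), oneAddLower_symm_eq,
    rightPart_eq hF V₀ hr]
  rfl

end Image

/-! ### Linear algebra of filtered vector spaces -/

section Filtrations

variable {k : Type*} [Field k]

theorem finrank_map_add_finrank_inf_ker {V W : Type*} [AddCommGroup V] [Module k V]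
    [FiniteDimensional k V] [AddCommGroup W] [Module k W] (f : V →ₗ[k] W) (K : Submodule k V) :
    Module.finrank k (K.map f) + Module.finrank k (K ⊓ LinearMap.ker f : Submodule k V) =
      Module.finrank k K := by
  rw [← LinearMap.finrank_range_add_finrank_ker (f.domRestrict K), LinearMap.range_domRestrict,
    LinearMap.ker_domRestrict, ← Submodule.finrank_map_subtype_eq, Submodule.map_comap_subtype]

/-- A filtration has splittings compatible with a given subspace `U`. -/
theorem exists_adapted_isCompl {V : Type*} [AddCommGroup V] [Module k V] {G : ℕ → Submodule k V}
    (hG : Monotone G) {t : ℕ} (ht : G t = ⊤) (U : Submodule k V) :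
    ∃ N, IsCompl U N ∧ ∀ i, G i ≤ (G i ⊓ U) ⊔ (G i ⊓ N) := by
  -- The complement grows along the filtration: at each step a complement of `(U ∩ G (t + 1)) + N`
  -- in `G (t + 1)` is added to `N`.
  have key : ∀ t, ∃ N, N ≤ G t ∧ Disjoint U N ∧ ∀ i ≤ t, G i ≤ (G i ⊓ U) ⊔ (G i ⊓ N) := by
    intro t
    induction t with
    | zero =>
      obtain ⟨N, hN, hsup⟩ := IsModularLattice.exists_disjoint_and_sup_eq
        (inf_le_right : U ⊓ G 0 ≤ G 0)
      have hle : N ≤ G 0 := hsup ▸ le_sup_right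
      refine ⟨N, hle, ?_, fun i hi => ?_⟩
      · rw [disjoint_iff, ← inf_eq_right.2 hle, ← inf_assoc, hN.eq_bot]
      · rw [Nat.le_zero.1 hi, inf_comm, inf_eq_right.2 hle, hsup]
    | succ t ih =>
      obtain ⟨N, hN, hd, hi⟩ := ih
      have hN' : N ≤ G (t + 1) := hN.trans (hG t.le_succ)
      obtain ⟨C, hC, hsup⟩ := IsModularLattice.exists_disjoint_and_sup_eq
        (sup_le inf_le_right hN' : (U ⊓ G (t + 1)) ⊔ N ≤ G (t + 1))
      have hle : N ⊔ C ≤ G (t + 1) := sup_le hN' (hsup ▸ le_sup_right)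
      have hdis : Disjoint (U ⊓ G (t + 1)) (N ⊔ C) :=
        Disjoint.disjoint_sup_right_of_disjoint_sup_left (hd.mono_left inf_le_left) hC
      refine ⟨N ⊔ C, hle, ?_, fun i hit => ?_⟩
      · rw [disjoint_iff, ← inf_eq_right.2 hle, ← inf_assoc, hdis.eq_bot]
      · rcases Nat.le_succ_iff.1 hit with h | rfl
        · exact (hi i h).trans (sup_le_sup_left (inf_le_inf_left _ le_sup_left) _)
        · rw [inf_comm, inf_eq_right.2 hle, ← sup_assoc, hsup]
  obtain ⟨N, -, hd, hi⟩ := key t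
  have htop : ∀ i, t ≤ i → G i = ⊤ := fun i h => top_le_iff.1 (ht ▸ hG h)
  have hc : Codisjoint U N := by
    have := hi t le_rfl
    rw [ht, top_inf_eq, top_inf_eq] at this
    exact codisjoint_iff.2 (top_le_iff.1 this)
  refine ⟨N, ⟨hd, hc⟩, fun i => ?_⟩
  rcases le_total i t with h | h
  · exact hi i h
  · rw [htop i h, top_inf_eq, top_inf_eq, hc.eq_top]

variable {V V' : Type*} [AddCommGroup V] [Module k V] [AddCommGroup V'] [Module k V']

theorem exists_glue {U N : Submodule k V} {U' N' : Submodule k V'} (h : IsCompl U N)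
    (h' : IsCompl U' N') (e₁ : U ≃ₗ[k] U') (e₂ : N ≃ₗ[k] N') :
    ∃ e : V ≃ₗ[k] V', (∀ u : U, e u = e₁ u) ∧ ∀ x : N, e x = e₂ x := by
  refine ⟨(Submodule.prodEquivOfIsCompl U N h).symm ≪≫ₗ e₁.prodCongr e₂ ≪≫ₗ
    Submodule.prodEquivOfIsCompl U' N' h', fun u => ?_, fun x => ?_⟩
  · rw [LinearEquiv.trans_apply, LinearEquiv.trans_apply,
      Submodule.prodEquivOfIsCompl_symm_apply_left]
    simp
  · rw [LinearEquiv.trans_apply, LinearEquiv.trans_apply,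
      Submodule.prodEquivOfIsCompl_symm_apply_right]
    simp

/-- Only the splitting of the source has to be adapted to the filtration, since elements are
decomposed there. -/
theorem exists_filtered_glue {G : ℕ → Submodule k V} {G' : ℕ → Submodule k V'}
    {U N : Submodule k V} {U' N' : Submodule k V'} (h : IsCompl U N)
    (h' : IsCompl U' N') (hN : ∀ i, G i ≤ (G i ⊓ U) ⊔ (G i ⊓ N)) (e₁ : U ≃ₗ[k] U')
    (e₂ : N ≃ₗ[k] N') (he₁ : ∀ i (u : U), u.1 ∈ G i → (e₁ u).1 ∈ G' i)
    (he₂ : ∀ i (u : N), u.1 ∈ G i → (e₂ u).1 ∈ G' i) :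
    ∃ e : V ≃ₗ[k] V', (∀ i, ∀ v ∈ G i, e v ∈ G' i) ∧ (∀ u : U, e u = e₁ u) ∧
      ∀ x : N, e x = e₂ x := by
  obtain ⟨e, h1, h2⟩ := exists_glue h h' e₁ e₂
  refine ⟨e, fun i v hv => ?_, h1, h2⟩
  obtain ⟨u, hu, x, hx, rfl⟩ := Submodule.mem_sup.1 (hN i hv)
  rw [map_add]
  refine add_mem ?_ ?_
  · rw [h1 ⟨u, hu.2⟩]
    exact he₁ i _ hu.1
  · rw [h2 ⟨x, hx.2⟩]
    exact he₂ i _ hx.1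

theorem finrank_comap_subtype (U G : Submodule k V) :
    Module.finrank k (G.comap U.subtype) = Module.finrank k (G ⊓ U : Submodule k V) := by
  rw [← Submodule.finrank_map_subtype_eq, Submodule.map_comap_subtype, inf_comm]

theorem finrank_add_of_adapted [FiniteDimensional k V] {G U N : Submodule k V} (h : Disjoint U N)
    (hG : G ≤ (G ⊓ U) ⊔ (G ⊓ N)) :
    Module.finrank k (G ⊓ U : Submodule k V) + Module.finrank k (G ⊓ N : Submodule k V) =
      Module.finrank k G := by
  rw [← Submodule.finrank_sup_add_finrank_inf_eq,
    (h.mono inf_le_right inf_le_right : Disjoint (G ⊓ U) (G ⊓ N)).eq_bot, finrank_bot, add_zero,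
    le_antisymm (sup_le inf_le_left inf_le_left) hG]

/-- Filtered spaces with the same dimensions are isomorphic. -/
theorem exists_filtered_equiv (t : ℕ) [FiniteDimensional k V] [FiniteDimensional k V']
    {G : ℕ → Submodule k V} {G' : ℕ → Submodule k V'}
    (hG : Monotone G) (hG' : Monotone G') (ht : G t = ⊤) (ht' : G' t = ⊤)
    (hd : ∀ i, Module.finrank k (G i) = Module.finrank k (G' i)) :
    ∃ e : V ≃ₗ[k] V', ∀ i, ∀ v ∈ G i, e v ∈ G' i := by
  induction t generalizing V V' with
  | zero =>
    have hVV : Module.finrank k V = Module.finrank k V' := by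
      rw [← finrank_top k V, ← finrank_top k V', ← ht, ← ht', hd]
    refine ⟨LinearEquiv.ofFinrankEq _ _ hVV, fun i v _ => ?_⟩
    exact hG' (Nat.zero_le i) (ht' ▸ Submodule.mem_top)
  | succ t ih =>
    -- Induction applies to `G t`. On its complement any isomorphism will do: steps up to `t` meet
    -- the complement in `0`, and later steps are everything.
    obtain ⟨N, hN, hNG⟩ := exists_adapted_isCompl hG ht (G t)
    obtain ⟨N', hN', -⟩ := exists_adapted_isCompl hG' ht' (G' t)
    have hVV : Module.finrank k V = Module.finrank k V' := by
      rw [← finrank_top k V, ← finrank_top k V', ← ht, ← ht', hd]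
    have hdN : Module.finrank k N = Module.finrank k N' := by
      have h1 := Submodule.finrank_add_eq_of_isCompl hN
      have h2 := Submodule.finrank_add_eq_of_isCompl hN'
      rw [hd] at h1
      omega
    obtain ⟨e₁, he₁⟩ := ih (V := G t) (V' := G' t)
      (G := fun i => (G i).comap (G t).subtype) (G' := fun i => (G' i).comap (G' t).subtype)
      (fun i j hij => Submodule.comap_mono (hG hij))
      (fun i j hij => Submodule.comap_mono (hG' hij)) 
      (Submodule.comap_subtype_self _) (Submodule.comap_subtype_self _) (fun i => by
        rw [finrank_comap_subtype, finrank_comap_subtype]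
        rcases le_total i t with h | h
        · rw [inf_eq_left.2 (hG h), inf_eq_left.2 (hG' h), hd]
        · rw [inf_eq_right.2 (hG h), inf_eq_right.2 (hG' h), hd])
    obtain ⟨e, he, -, -⟩ := exists_filtered_glue (G := G) (G' := G') hN hN' hNG e₁
      (LinearEquiv.ofFinrankEq _ _ hdN) (fun i u hu => he₁ i u hu) (fun i u hu => by
        rcases le_or_gt i t with h | h
        · have h0 : u.1 = 0 := Submodule.disjoint_def.1 hN.disjoint _ (hG h hu) u.2
          rw [show u = 0 from Subtype.ext h0, map_zero]
          exact zero_mem _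
        · exact hG' h (ht' ▸ Submodule.mem_top))
    exact ⟨e, he⟩

variable [FiniteDimensional k V] [FiniteDimensional k V']
variable {W W' : Type*} [AddCommGroup W] [Module k W] [AddCommGroup W'] [Module k W']

/-- Lifting of a filtered isomorphism along maps out of filtered spaces. -/
theorem exists_filtered_lift {t : ℕ} {G : ℕ → Submodule k V} {G' : ℕ → Submodule k V'}
    (hG : Monotone G) (hG' : Monotone G') (ht : G t = ⊤) (ht' : G' t = ⊤)
    (hd : ∀ i, Module.finrank k (G i) = Module.finrank k (G' i))
    (f : V →ₗ[k] W) (f' : V' →ₗ[k] W')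
    (hdm : ∀ i, Module.finrank k ((G i).map f) = Module.finrank k ((G' i).map f'))
    (g : W ≃ₗ[k] W') (hg : ∀ i, ∀ y ∈ (G i).map f, g y ∈ (G' i).map f') :
    ∃ h : V ≃ₗ[k] V', (∀ i, ∀ v ∈ G i, h v ∈ G' i) ∧ ∀ v, f' (h v) = g (f v) := by
  set U := LinearMap.ker f
  set U' := LinearMap.ker f'
  obtain ⟨N, hN, hNG⟩ := exists_adapted_isCompl hG ht U
  obtain ⟨N', hN', hNG'⟩ := exists_adapted_isCompl hG' ht' U'
  have hker : ∀ i, Module.finrank k (G i ⊓ U : Submodule k V) =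
      Module.finrank k (G' i ⊓ U' : Submodule k V') := by
    intro i
    have h1 := finrank_map_add_finrank_inf_ker f (G i)
    have h2 := finrank_map_add_finrank_inf_ker f' (G' i)
    rw [hdm, hd] at h1
    change Module.finrank k (G i ⊓ LinearMap.ker f : Submodule k V) =
      Module.finrank k (G' i ⊓ LinearMap.ker f' : Submodule k V')
    omega
  obtain ⟨e₁, he₁⟩ := exists_filtered_equiv t (V := U) (V' := U')
    (G := fun i => (G i).comap U.subtype) (G' := fun i => (G' i).comap U'.subtype)
    (fun i j hij => Submodule.comap_mono (hG hij))
    (fun i j hij => Submodule.comap_mono (hG' hij))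
    (by simp [ht]) (by simp [ht']) (fun i => by
      rw [finrank_comap_subtype, finrank_comap_subtype, hker])
  have hrange : (LinearMap.range f).map (g : W →ₗ[k] W') = LinearMap.range f' := by
    have h1 := hg t
    have h2 := hdm t
    rw [ht, ht', Submodule.map_top, Submodule.map_top] at h1 h2
    refine Submodule.eq_of_le_of_finrank_eq ?_ ?_
    · rintro _ ⟨y, hy, rfl⟩
      exact h1 y hy
    · rw [LinearEquiv.finrank_map_eq, h2]
  -- The complements of the kernels are identified with the ranges, so there the lift is forced to
  -- be `g`.
  let e₂ : N ≃ₗ[k] N' := f.kerComplementEquivRange hN.symm ≪≫ₗ g.ofSubmodules _ _ hrange ≪≫ₗ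
    (f'.kerComplementEquivRange hN'.symm).symm
  have he₂ : ∀ x : N, f' (e₂ x) = g (f x) := by
    intro x
    have h1 : f'.kerComplementEquivRange hN'.symm (e₂ x) =
        g.ofSubmodules _ _ hrange (f.kerComplementEquivRange hN.symm x) :=
      LinearEquiv.apply_symm_apply _ _
    exact congrArg Subtype.val h1
  -- That `e₂` is filtered uses adaptedness of `N'`: a preimage of `g (f x)` in `G' i` has its
  -- `N'`-component in `G' i`, and this component must be `e₂ x`.
  obtain ⟨h, h1, h2, h3⟩ := exists_filtered_glue (G := G) (G' := G') hN hN' hNG e₁ e₂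
    (fun i u hu => he₁ i u hu) (fun i x hx => by
      obtain ⟨y, hy, hfy⟩ := hg i _ (Submodule.mem_map_of_mem hx)
      obtain ⟨u, hu, z, hz, rfl⟩ := Submodule.mem_sup.1 (hNG' i hy)
      rw [map_add, LinearMap.mem_ker.1 hu.2, zero_add, ← he₂] at hfy
      have h0 : (e₂ x).1 - z = 0 := Submodule.disjoint_def.1 hN'.disjoint _
        (by rw [LinearMap.mem_ker, map_sub, hfy, sub_self]) (sub_mem (e₂ x).2 hz.2)
      rw [sub_eq_zero.1 h0]
      exact hz.1)
  refine ⟨h, h1, fun v => ?_⟩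
  obtain ⟨u, hu, x, hx, rfl⟩ := Submodule.mem_sup.1
    (show v ∈ U ⊔ N from hN.sup_eq_top ▸ Submodule.mem_top)
  rw [map_add, map_add, map_add, map_add, h2 ⟨u, hu⟩, h3 ⟨x, hx⟩, he₂, LinearMap.mem_ker.1 hu,
    LinearMap.mem_ker.1 (e₁ ⟨u, hu⟩).2, map_zero]

/-- Extension of a filtered isomorphism along maps into filtered spaces. -/
theorem exists_filtered_extension [FiniteDimensional k W] [FiniteDimensional k W'] {t : ℕ}
    {G : ℕ → Submodule k V} {G' : ℕ → Submodule k V'}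
    (hG : Monotone G) (hG' : Monotone G') (h0 : G 0 = ⊥) (h0' : G' 0 = ⊥) (ht : G t = ⊤)
    (ht' : G' t = ⊤) (hd : ∀ i, Module.finrank k (G i) = Module.finrank k (G' i))
    (f : W →ₗ[k] V) (f' : W' →ₗ[k] V')
    (hdc : ∀ i, Module.finrank k ((G i).comap f) = Module.finrank k ((G' i).comap f'))
    (g : W ≃ₗ[k] W') (hg : ∀ i, ∀ y ∈ (G i).comap f, g y ∈ (G' i).comap f') :
    ∃ h : V ≃ₗ[k] V', (∀ i, ∀ v ∈ G i, h v ∈ G' i) ∧ ∀ y, h (f y) = f' (g y) := by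
  set U := LinearMap.range f with hU
  set U' := LinearMap.range f' with hU'
  obtain ⟨N, hN, hNG⟩ := exists_adapted_isCompl hG ht U
  obtain ⟨N', hN', hNG'⟩ := exists_adapted_isCompl hG' ht' U'
  -- The step `0`, where the filtrations vanish, says that `g` matches the kernels. Hence `g`
  -- descends to an isomorphism of the ranges.
  have hker : (LinearMap.ker f).map (g : W →ₗ[k] W') = LinearMap.ker f' := by
    have h1 := hg 0
    have h2 := hdc 0
    rw [h0, h0', Submodule.comap_bot, Submodule.comap_bot] at h1 h2
    refine Submodule.eq_of_le_of_finrank_eq ?_ ?_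
    · rintro _ ⟨y, hy, rfl⟩
      exact h1 y hy
    · rw [LinearEquiv.finrank_map_eq, h2]
  have hdk : Module.finrank k (LinearMap.ker f) = Module.finrank k (LinearMap.ker f') := by
    rw [← hker, LinearEquiv.finrank_map_eq]
  have hrange : ∀ i, Module.finrank k (G i ⊓ U : Submodule k V) =
      Module.finrank k (G' i ⊓ U' : Submodule k V') := by
    intro i
    have h1 := finrank_map_add_finrank_inf_ker f ((G i).comap f)
    have h2 := finrank_map_add_finrank_inf_ker f' ((G' i).comap f')
    rw [Submodule.map_comap_eq, inf_comm, inf_eq_right.2 (LinearMap.ker_le_comap f)] at h1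
    rw [Submodule.map_comap_eq, inf_comm, inf_eq_right.2 (LinearMap.ker_le_comap f')] at h2
    rw [hdc, hdk] at h1
    change Module.finrank k (G i ⊓ LinearMap.range f : Submodule k V) =
      Module.finrank k (G' i ⊓ LinearMap.range f' : Submodule k V')
    omega
  obtain ⟨e₂, he₂⟩ := exists_filtered_equiv t (V := N) (V' := N')
    (G := fun i => (G i).comap N.subtype) (G' := fun i => (G' i).comap N'.subtype)
    (fun i j hij => Submodule.comap_mono (hG hij))
    (fun i j hij => Submodule.comap_mono (hG' hij))
    (by simp [ht]) (by simp [ht']) (fun i => by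
      rw [finrank_comap_subtype, finrank_comap_subtype]
      have h1 := finrank_add_of_adapted hN.disjoint (hNG i)
      have h2 := finrank_add_of_adapted hN'.disjoint (hNG' i)
      rw [hd, hrange] at h1
      omega)
  let e₁ : U ≃ₗ[k] U' := f.quotKerEquivRange.symm ≪≫ₗ
    Submodule.Quotient.equiv _ _ g hker ≪≫ₗ f'.quotKerEquivRange
  have he₁ : ∀ y, (e₁ ⟨f y, y, rfl⟩ : V') = f' (g y) := by
    intro y
    have hy : f.quotKerEquivRange.symm ⟨f y, y, rfl⟩ = Submodule.Quotient.mk y := by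
      rw [LinearEquiv.symm_apply_eq]
      rfl
    simp only [e₁, LinearEquiv.trans_apply, hy]
    rfl
  obtain ⟨h, h1, h2, h3⟩ := exists_filtered_glue (G := G) (G' := G') hN hN' hNG e₁ e₂
    (fun i u hu => by
      obtain ⟨_, y, rfl⟩ := u
      rw [he₁]
      exact hg i y hu) (fun i x hx => he₂ i x hx)
  exact ⟨h, h1, fun y => by rw [h2 ⟨f y, y, rfl⟩, he₁]⟩

end Filtrations

/-! ### The filtration at a vertex and its dimensions -/

section VertexFiltration

variable {k : Type*} [Field k] {n : ℕ} {o : Fin n → Bool} {d : Fin (n + 1) → ℕ}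

/-- The filtration of `V x` given by the part of `V` to the left of `x`. -/
def filt (V : Rep k o d) : ∀ x : Fin (n + 1), ℤ → Submodule k (Fin (d x) → k) :=
  Fin.induction (fun i => if 0 ≤ i then ⊤ else ⊥) fun e F i =>
    if o e = true then (if (e : ℤ) + 1 ≤ i then ⊤ else (F i).map (rightStep V e))
    else (if i < -((e : ℤ) + 1) then ⊥ else (F i).comap (leftStep V e))

theorem filt_zero (V : Rep k o d) (i : ℤ) : filt V 0 i = if 0 ≤ i then ⊤ else ⊥ := rfl

theorem filt_succ_of_true (V : Rep k o d) {e : Fin n} (h : o e = true) (i : ℤ) :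
    filt V e.succ i =
      if (e : ℤ) + 1 ≤ i then ⊤ else (filt V e.castSucc i).map (rightStep V e) := by
  change (if o e = true then _ else _) = _
  rw [if_pos h]
  rfl

theorem filt_succ_of_false (V : Rep k o d) {e : Fin n} (h : o e = false) (i : ℤ) :
    filt V e.succ i =
      if i < -((e : ℤ) + 1) then ⊥ else (filt V e.castSucc i).comap (leftStep V e) := by
  change (if o e = true then _ else _) = _
  rw [if_neg (by simp [h])]
  rfl

theorem filt_eq_top (V : Rep k o d) (x : Fin (n + 1)) {i : ℤ} (hi : (x : ℕ) ≤ i) :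
    filt V x i = ⊤ := by
  induction x using Fin.induction with
  | zero => rw [filt_zero, if_pos (by simpa using hi)]
  | succ e ih =>
    simp only [Fin.val_succ, Nat.cast_add, Nat.cast_one] at hi
    rcases h : o e with _ | _
    · rw [filt_succ_of_false V h, if_neg (by omega), ih (by simp; omega), Submodule.comap_top]
    · rw [filt_succ_of_true V h, if_pos hi]

theorem filt_eq_bot (V : Rep k o d) (x : Fin (n + 1)) {i : ℤ} (hi : i < -((x : ℕ) : ℤ)) :
    filt V x i = ⊥ := by
  induction x using Fin.induction with
  | zero => rw [filt_zero, if_neg (by simpa using hi)]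
  | succ e ih =>
    simp only [Fin.val_succ, Nat.cast_add, Nat.cast_one] at hi
    rcases h : o e with _ | _
    · rw [filt_succ_of_false V h, if_pos hi]
    · rw [filt_succ_of_true V h, if_neg (by omega), ih (by simp; omega), Submodule.map_bot]

theorem filt_mono (V : Rep k o d) (x : Fin (n + 1)) : Monotone (filt V x) := by
  intro i j hij
  induction x using Fin.induction with
  | zero =>
    rw [filt_zero, filt_zero]
    split_ifs
    · exact le_rfl
    · omega
    · exact bot_le
    · exact le_rfl
  | succ e ih =>
    rcases h : o e with _ | _
    · rw [filt_succ_of_false V h, filt_succ_of_false V h]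
      split_ifs
      · exact le_rfl
      · exact bot_le
      · omega
      · exact Submodule.comap_mono ih
    · rw [filt_succ_of_true V h, filt_succ_of_true V h]
      split_ifs
      · exact le_rfl
      · omega
      · exact le_top
      · exact Submodule.map_mono ih

/-- From index `e` on, the filtration at the source is already everything, so the image stops
growing there. In the target the next step, at `e + 1`, fills the whole space. -/
theorem map_rightStep_filt (V : Rep k o d) {e : Fin n} (h : o e = true) (i : ℤ) :
    (filt V e.castSucc i).map (rightStep V e) = filt V e.succ (min i e) := by
  rw [filt_succ_of_true V h, if_neg (by omega)]
  rcases le_total i e with hi | hi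
  · rw [min_eq_left hi]
  · rw [min_eq_right hi, filt_eq_top V _ (by simpa using hi), filt_eq_top V _ (by simp)]

/-- Below `-e` the filtration at the target of the arrow is `0`, so the preimage is the kernel. This
is the step of index `-(e + 1)`; the filtration at the source drops to `0` below it. -/
theorem comap_leftStep_filt (V : Rep k o d) {e : Fin n} (h : o e = false) (i : ℤ) :
    (filt V e.castSucc i).comap (leftStep V e) = filt V e.succ (max i (-((e : ℤ) + 1))) := by
  rw [filt_succ_of_false V h, if_neg (by omega)]
  rcases le_total (-((e : ℤ) + 1)) i with hi | hi
  · rw [max_eq_left hi]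
  · rw [max_eq_right hi, filt_eq_bot V _ (by simp; omega), filt_eq_bot V _ (by simp)]

theorem oneSubRight_congr (V : Rep k o d) {w w' : Vec k d} {z : Fin (n + 1)}
    (h : ∀ y ≤ z, w y = w' y) : oneSubRight V w z = oneSubRight V w' z := by
  cases z using Fin.cases with
  | zero => rw [oneSubRight_zero, oneSubRight_zero, h _ le_rfl]
  | succ e =>
    rw [oneSubRight_succ, oneSubRight_succ, h _ le_rfl, h _ (Fin.castSucc_lt_succ).le]

theorem oneAddLeft_congr (V : Rep k o d) {w w' : Vec k d} {z x : Fin (n + 1)} (hz : z < x)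
    (h : ∀ y ≤ x, w y = w' y) : oneAddLeft V w z = oneAddLeft V w' z := by
  cases z using Fin.lastCases with
  | last => exact absurd hz (not_lt.2 (Fin.le_last x))
  | cast e =>
    rw [oneAddLeft_castSucc, oneAddLeft_castSucc, h _ hz.le, h _ (Fin.castSucc_lt_iff_succ_le.1 hz)]

/-- The rows of key at least `n - x + 1` are the vertices left of `x` that do not start a right
arrow. Up to `x`, the equations of the null space thus say `w_{z+1} = B w_z` on right arrows and
`w_z = -A w_{z+1}` on left arrows, except where the threshold `i` frees or kills a component; this
is the recursion of `filt`. -/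
theorem mem_filt_of_mem_nullSpace (V : Rep k o d) {x : Fin (n + 1)} {i : ℤ} {w : Vec k d}
    (hw : w ∈ nullSpace o (oneSubRight V) (oneAddLeft V) ((n : ℤ) - (x : ℕ) + 1) i)
    {y : Fin (n + 1)} (hy : y ≤ x) : w y ∈ filt V y i := by
  induction y using Fin.induction with
  | zero =>
    rw [filt_zero]
    split_ifs with hi
    · exact Submodule.mem_top
    · rw [Submodule.mem_bot, ← oneSubRight_zero V w]
      exact hw.1 0 (by rw [key₂_zero]; omega)
  | succ e ih =>
    have hlt : e.castSucc < x := (Fin.castSucc_lt_succ).trans_le hy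
    have ih := ih hlt.le
    rcases h : o e with _ | _
    · have hkey : key₂ o e.succ = -((e : ℤ) + 1) := by rw [key₂_succ, h]; rfl
      rw [filt_succ_of_false V h]
      split_ifs with hi
      · have := hw.1 e.succ (by rw [hkey]; exact hi)
        rw [oneSubRight_succ, rightStep_of_false V h, LinearMap.zero_apply, sub_zero] at this
        rw [this]
        exact zero_mem _
      · have h1 : (n : ℤ) - (x : ℕ) + 1 ≤ key₁ o e.castSucc := by
          rw [key₁_castSucc, h, if_neg (by simp)]
          have := Fin.lt_def.1 hlt
          rw [Fin.val_castSucc] at this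
          omega
        have := hw.2 _ h1
        rw [oneAddLeft_castSucc] at this
        rw [Submodule.mem_comap, ← neg_mem_iff, ← eq_neg_of_add_eq_zero_left this]
        exact ih
    · have hkey : key₂ o e.succ = (e : ℤ) + 1 := by rw [key₂_succ, h]; rfl
      rw [filt_succ_of_true V h]
      split_ifs with hi
      · exact Submodule.mem_top
      · have := hw.1 e.succ (by rw [hkey]; omega)
        rw [oneSubRight_succ, sub_eq_zero] at this
        exact ⟨_, ih, this.symm⟩

theorem exists_family_of_mem_filt (V : Rep k o d) (x : Fin (n + 1)) {i : ℤ} {v : Fin (d x) → k}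
    (hv : v ∈ filt V x i) : ∃ w : Vec k d, w x = v ∧
      (∀ z ≤ x, i < key₂ o z → oneSubRight V w z = 0) ∧
      ∀ z < x, ¬ StartsRight o z → oneAddLeft V w z = 0 := by
  induction x using Fin.induction with
  | zero =>
    refine ⟨Function.update 0 0 v, Function.update_self .., fun z hz hi => ?_,
      fun z hz => absurd hz (Fin.not_lt_zero z)⟩
    obtain rfl : z = 0 := Fin.le_zero_iff.1 hz
    rw [key₂_zero] at hi
    rw [filt_zero, if_neg (not_le.2 hi), Submodule.mem_bot] at hv
    rw [oneSubRight_zero, Function.update_self, hv]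
  | succ e ih =>
    -- A family ending in `u` is extended by `v`. For a left arrow `u` is `-Av`, or `0` when `v` is
    -- forced to vanish; for a right arrow it is a preimage of `v`, or `0` when `v` is free.
    have hstep : ∀ u ∈ filt V e.castSucc i,
        (i < key₂ o e.succ → v = rightStep V e u) →
        (o e = false → u + leftStep V e v = 0) → ∃ w : Vec k d, w e.succ = v ∧
          (∀ z ≤ e.succ, i < key₂ o z → oneSubRight V w z = 0) ∧
          ∀ z < e.succ, ¬ StartsRight o z → oneAddLeft V w z = 0 := by
      intro u hu h1 h2
      obtain ⟨w, hwx, hw1, hw2⟩ := ih hu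
      have hne : ∀ y ≤ e.castSucc, Function.update w e.succ v y = w y := fun y hy =>
        Function.update_of_ne (hy.trans_lt Fin.castSucc_lt_succ).ne _ _
      refine ⟨Function.update w e.succ v, Function.update_self .., fun z hz hi => ?_,
        fun z hz hs => ?_⟩
      · rcases hz.lt_or_eq with hz | rfl
        · have hz := Fin.le_castSucc_iff.2 hz
          rw [oneSubRight_congr V fun y hy => hne y (hy.trans hz), hw1 z hz hi]
        · rw [oneSubRight_succ, Function.update_self, hne _ le_rfl, hwx, h1 hi, sub_self]
      · rcases (Fin.le_castSucc_iff.2 hz).lt_or_eq with hz | rfl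
        · rw [oneAddLeft_congr V hz hne, hw2 z hz hs]
        · rw [oneAddLeft_castSucc, Function.update_self, hne _ le_rfl, hwx]
          rw [startsRight_castSucc, Bool.not_eq_true] at hs
          exact h2 hs
    rcases h : o e with _ | _
    · have hkey : key₂ o e.succ = -((e : ℤ) + 1) := by rw [key₂_succ, h]; rfl
      rw [filt_succ_of_false V h] at hv
      split_ifs at hv with hi
      · rw [Submodule.mem_bot] at hv
        exact hstep 0 (zero_mem _) (fun _ => by rw [hv, map_zero])
          (fun _ => by rw [hv, map_zero, add_zero])
      · exact hstep (-leftStep V e v) (neg_mem hv) (fun h => by omega)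
          (fun _ => neg_add_cancel _)
    · have hkey : key₂ o e.succ = (e : ℤ) + 1 := by rw [key₂_succ, h]; rfl
      rw [filt_succ_of_true V h] at hv
      split_ifs at hv with hi
      · exact hstep 0 (zero_mem _) (fun _ => by omega) (fun h' => by simp [h] at h')
      · obtain ⟨u, hu, rfl⟩ := hv
        exact hstep u hu (fun _ => rfl) (fun h' => by simp [h] at h')

theorem exists_mem_nullSpace (V : Rep k o d) (x : Fin (n + 1)) {i : ℤ} {v : Fin (d x) → k}
    (hv : v ∈ filt V x i) (u : Vec k d) :
    ∃ w ∈ nullSpace o (oneSubRight V) (oneAddLeft V) ((n : ℤ) - (x : ℕ) + 1) i,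
      w x = v ∧ ∀ z, x < z → key₂ o z ≤ i → w z = u z := by
  have key : ∀ y : Fin (n + 1), ∃ w : Vec k d, w x = v ∧
      (∀ z, z ≤ x ∨ z ≤ y → i < key₂ o z → oneSubRight V w z = 0) ∧
      (∀ z < x, ¬ StartsRight o z → oneAddLeft V w z = 0) ∧
      ∀ z, x < z → z ≤ y → key₂ o z ≤ i → w z = u z := by
    intro y
    induction y using Fin.induction with
    | zero =>
      obtain ⟨w, h1, h2, h3⟩ := exists_family_of_mem_filt V x hv
      refine ⟨w, h1, fun z hz => h2 z (hz.elim id fun h => ?_), h3, fun z hx hz => ?_⟩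
      · exact h.trans (Fin.zero_le x)
      · exact absurd (hx.trans_le hz) (Fin.not_lt_zero x)
    | succ e ih =>
      obtain ⟨w, h1, h2, h3, h4⟩ := ih
      rcases le_or_gt e.succ x with hex | hex
      · refine ⟨w, h1, fun z hz => h2 z (Or.inl (hz.elim id fun h => h.trans hex)), h3,
          fun z hx hz => ?_⟩
        exact absurd (hx.trans_le hz) (not_lt.2 hex)
      · have hxe : x ≤ e.castSucc := Fin.le_castSucc_iff.2 hex
        -- To the right of `x` only the equations for `1 - B` remain: a component is free if its key
        -- is at most `i`, and otherwise determined by its left neighbour.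
        let v' : Fin (d e.succ) → k :=
          if key₂ o e.succ ≤ i then u e.succ else rightStep V e (w e.castSucc)
        have hne : ∀ y ≤ e.castSucc, Function.update w e.succ v' y = w y := fun y hy =>
          Function.update_of_ne (hy.trans_lt Fin.castSucc_lt_succ).ne _ _
        refine ⟨Function.update w e.succ v', by rw [hne x hxe, h1], fun z hz hi => ?_,
          fun z hz hs => ?_, fun z hx hz hi => ?_⟩
        · rcases eq_or_ne z e.succ with rfl | hze
          · rw [oneSubRight_succ, Function.update_self, hne _ le_rfl]
            simp only [v']
            rw [if_neg (not_le.2 hi), sub_self]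
          · have hz' : z ≤ e.castSucc :=
              hz.elim (fun h => h.trans hxe) fun h => Fin.le_castSucc_iff.2 (lt_of_le_of_ne h hze)
            rw [oneSubRight_congr V fun y hy => hne y (hy.trans hz'), h2 z (Or.inr hz') hi]
        · rw [oneAddLeft_congr V hz fun y hy => hne y (hy.trans hxe), h3 z hz hs]
        · rcases hz.lt_or_eq with hz | rfl
          · have hz := Fin.le_castSucc_iff.2 hz
            rw [hne z hz, h4 z hx hz hi]
          · rw [Function.update_self]
            exact if_pos hi
  obtain ⟨w, h1, h2, h3, h4⟩ := key (Fin.last n)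
  refine ⟨w, ⟨fun z => h2 z (Or.inr (Fin.le_last z)), fun z hz => ?_⟩, h1,
    fun z hx => h4 z hx (Fin.le_last z)⟩
  have hzn := z.2
  have hxn := x.2
  by_cases hs : StartsRight o z
  · rw [key₁_of_startsRight hs] at hz
    omega
  · rw [key₁_of_not_startsRight hs] at hz
    exact h3 z (Fin.lt_def.2 (by omega)) hs

/-- The rows of key at least `x - n` include all vertices from `x` on, so lowering the threshold
forces `w` to vanish there. Conversely, once `w` is zero at `x` and at the free vertices, the
equations for `1 - B` propagate zero to the right. -/
theorem mem_nullSpace_iff_vanish (V : Rep k o d) (x : Fin (n + 1)) (i : ℤ) (w : Vec k d) :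
    w ∈ nullSpace o (oneSubRight V) (oneAddLeft V) ((x : ℕ) - (n : ℤ)) i ↔
      w ∈ nullSpace o (oneSubRight V) (oneAddLeft V) ((n : ℤ) - (x : ℕ) + 1) i ∧ w x = 0 ∧
        ∀ z, x < z → key₂ o z ≤ i → w z = 0 := by
  have hxn := x.2
  constructor
  · rintro ⟨h1, h2⟩
    have h0 : ∀ z : Fin (n + 1), (x : ℕ) ≤ z → w z = 0 := by
      refine eq_zero_of_oneAddLeft_eq_zero V fun z hz => h2 z ?_
      have := z.2
      unfold key₁
      split_ifs <;> omega
    exact ⟨⟨h1, fun z hz => h2 z (by omega)⟩, h0 x le_rfl, fun z hz _ => h0 z (le_of_lt hz)⟩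
  · rintro ⟨⟨h1, h2⟩, hx, h3⟩
    have h0 : ∀ z : Fin (n + 1), x ≤ z → w z = 0 := by
      intro z hz
      induction z using Fin.induction with
      | zero => rw [← Fin.le_zero_iff.1 hz, hx]
      | succ e ih =>
        rcases hz.lt_or_eq with hlt | rfl
        · rcases le_or_gt (key₂ o e.succ) i with hi | hi
          · exact h3 _ hlt hi
          · have := h1 _ hi
            rwa [oneSubRight_succ, ih (Fin.le_castSucc_iff.2 hlt), map_zero, sub_zero] at this
        · exact hx
    refine ⟨h1, fun z hz => ?_⟩
    rcases le_or_gt x z with hxz | hxz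
    · cases z using Fin.lastCases with
      | last => rw [oneAddLeft_last, h0 _ hxz]
      | cast e =>
        rw [oneAddLeft_castSucc, h0 _ hxz, h0 _ (hxz.trans (Fin.castSucc_lt_succ).le), map_zero,
          add_zero]
    · have hxz := Fin.lt_def.1 hxz
      refine h2 z ?_
      by_cases hs : StartsRight o z
      · rw [key₁_of_startsRight hs] at hz
        omega
      · rw [key₁_of_not_startsRight hs]
        omega

theorem finrank_prod_top {V W : Type*} [AddCommGroup V] [Module k V]
    [FiniteDimensional k V] [AddCommGroup W] [Module k W] [FiniteDimensional k W]
    (p : Submodule k V) :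
    Module.finrank k (p.prod (⊤ : Submodule k W)) = Module.finrank k p + Module.finrank k W := by
  have h : p.prod (⊤ : Submodule k W) = LinearMap.range (p.subtype.prodMap LinearMap.id) := by
    rw [LinearMap.range_prodMap, Submodule.range_subtype, LinearMap.range_id]
  rw [h, LinearMap.finrank_range_of_inj, Module.finrank_prod]
  exact Prod.map_injective.2 ⟨Subtype.val_injective, Function.injective_id⟩

/-- Rank-nullity for the projection of the larger null space to the component at `x` and the free
components to its right: the image is `filt V x i` times everything, the kernel is the smaller null
space. -/
theorem finrank_filt_add (V : Rep k o d) (x : Fin (n + 1)) (i : ℤ) :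
    Module.finrank k (filt V x i) +
      Module.finrank k (∀ z : {z // x < z ∧ key₂ o z ≤ i}, Fin (d z.1) → k) +
      Module.finrank k (nullSpace o (oneSubRight V) (oneAddLeft V) ((x : ℕ) - (n : ℤ)) i) =
    Module.finrank k
      (nullSpace o (oneSubRight V) (oneAddLeft V) ((n : ℤ) - (x : ℕ) + 1) i) := by
  set K := nullSpace o (oneSubRight V) (oneAddLeft V) ((n : ℤ) - (x : ℕ) + 1) i
  let g : Vec k d →ₗ[k]
      (Fin (d x) → k) × ∀ z : {z // x < z ∧ key₂ o z ≤ i}, Fin (d z.1) → k :=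
    (LinearMap.proj x).prod (LinearMap.pi fun z => LinearMap.proj z.1)
  have hmap : K.map g = (filt V x i).prod ⊤ := by
    refine le_antisymm ?_ ?_
    · rintro _ ⟨w, hw, rfl⟩
      exact ⟨mem_filt_of_mem_nullSpace V hw le_rfl, Submodule.mem_top⟩
    · rintro ⟨v, u⟩ ⟨hv, -⟩
      classical
      obtain ⟨w, hw, hwx, hwu⟩ := exists_mem_nullSpace V x hv
        (fun z => if h : x < z ∧ key₂ o z ≤ i then u ⟨z, h⟩ else 0)
      refine ⟨w, hw, Prod.ext hwx ?_⟩
      funext z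
      exact (hwu z.1 z.2.1 z.2.2).trans (dif_pos z.2)
  have hker : K ⊓ LinearMap.ker g =
      nullSpace o (oneSubRight V) (oneAddLeft V) ((x : ℕ) - (n : ℤ)) i := by
    ext w
    rw [mem_nullSpace_iff_vanish, Submodule.mem_inf, LinearMap.mem_ker]
    refine and_congr_right fun _ => ⟨fun h => ?_, fun h => ?_⟩
    · exact ⟨congrArg Prod.fst h, fun z hz hi => congrFun (congrArg Prod.snd h) ⟨z, hz, hi⟩⟩
    · refine Prod.ext h.1 ?_
      funext z
      exact h.2 z.1 z.2.1 z.2.2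
  rw [← finrank_map_add_finrank_inf_ker g K, hker, hmap, finrank_prod_top]

end VertexFiltration

/-! ### Equal ranks imply isomorphism, and conversely -/

section Isomorphism

variable {k : Type*} [Field k] {n : ℕ} {o : Fin n → Bool} {d : Fin (n + 1) → ℕ}

theorem finrank_filt_eq {V V' : Rep k o d}
    (hr : ∀ c i, blockRank o (zetaBlock V) c i = blockRank o (zetaBlock V') c i)
    (x : Fin (n + 1)) (i : ℤ) :
    Module.finrank k (filt V x i) = Module.finrank k (filt V' x i) := by
  have hnull : ∀ c i, Module.finrank k (nullSpace o (oneSubRight V) (oneAddLeft V) c i) =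
      Module.finrank k (nullSpace o (oneSubRight V') (oneAddLeft V') c i) := by
    intro c i
    have h1 := finrank_nullSpace_add_zeta V c i
    rw [← finrank_nullSpace_add_zeta V' c i, hr] at h1
    omega
  have h1 := finrank_filt_add V x i
  have h2 := finrank_filt_add V' x i
  rw [hnull, hnull] at h1
  omega

/-- The filtration `filt V x`, numbered by natural numbers. -/
def natFilt (V : Rep k o d) (x : Fin (n + 1)) (j : ℕ) : Submodule k (Fin (d x) → k) :=
  filt V x (j - (n + 1))

theorem natFilt_mono (V : Rep k o d) (x : Fin (n + 1)) : Monotone (natFilt V x) :=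
  fun i j hij => filt_mono V x (by omega)

/-- The filtration at `x` is `0` below index `-x` and everything from `x` on, so the shifted indices
from `0` to `2n + 1` cover all its jumps for every vertex, starting from `0`. -/
theorem natFilt_zero (V : Rep k o d) (x : Fin (n + 1)) : natFilt V x 0 = ⊥ :=
  filt_eq_bot V x (by have := x.2; omega)

theorem natFilt_top (V : Rep k o d) (x : Fin (n + 1)) : natFilt V x (2 * n + 1) = ⊤ :=
  filt_eq_top V x (by have := x.2; push_cast; omega)

theorem forall_filt_of_forall_natFilt {V V' : Rep k o d} {x : Fin (n + 1)}
    {e : (Fin (d x) → k) ≃ₗ[k] (Fin (d x) → k)}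
    (h : ∀ j, ∀ v ∈ natFilt V x j, e v ∈ natFilt V' x j) (i : ℤ) :
    ∀ v ∈ filt V x i, e v ∈ filt V' x i := by
  intro v hv
  rcases lt_or_ge i (-((n : ℤ) + 1)) with hi | hi
  · rw [filt_eq_bot V x (by have := x.2; omega), Submodule.mem_bot] at hv
    rw [hv, map_zero]
    exact zero_mem _
  · have hj : (((i + (n + 1)).toNat : ℕ) : ℤ) - (n + 1) = i := by omega
    have := h (i + (n + 1)).toNat v
    unfold natFilt at this
    rw [hj] at this
    exact this hv

/-- Induction from the rightmost vertex: a filtered isomorphism at `i + 1` is lifted along a right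
arrow or extended along a left arrow to one at `i`. It respects the image or preimage filtration
because that filtration consists of steps of the filtration at `i + 1`. -/
theorem exists_equiv_of_blockRank_eq {V V' : Rep k o d}
    (hr : ∀ c i, blockRank o (zetaBlock V) c i = blockRank o (zetaBlock V') c i) :
    ∃ e : ∀ x, (Fin (d x) → k) ≃ₗ[k] (Fin (d x) → k), ∀ i : Fin n,
      (∀ v, e i.succ (rightStep V i v) = rightStep V' i (e i.castSucc v)) ∧
        ∀ v, e i.castSucc (leftStep V i v) = leftStep V' i (e i.succ v) := by
  have hd := finrank_filt_eq hr
  have key : ∀ y : Fin (n + 1), ∃ e : ∀ x, (Fin (d x) → k) ≃ₗ[k] (Fin (d x) → k),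
      (∀ i, ∀ v ∈ filt V y i, e y v ∈ filt V' y i) ∧ ∀ i : Fin n, y ≤ i.castSucc →
        (∀ v, e i.succ (rightStep V i v) = rightStep V' i (e i.castSucc v)) ∧
          ∀ v, e i.castSucc (leftStep V i v) = leftStep V' i (e i.succ v) := by
    intro y
    induction y using Fin.reverseInduction with
    | last =>
      obtain ⟨e, he⟩ := exists_filtered_equiv (2 * n + 1) (natFilt_mono V (Fin.last n))
        (natFilt_mono V' (Fin.last n)) (natFilt_top V _) (natFilt_top V' _) fun i => hd _ _
      refine ⟨Function.update (fun _ => LinearEquiv.refl k _) (Fin.last n) e, ?_, fun i hi => ?_⟩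
      · rw [Function.update_self]
        exact forall_filt_of_forall_natFilt he
      · exact absurd (Fin.castSucc_lt_last i) (not_lt.2 hi)
    | cast i ih =>
      obtain ⟨e, he, hc⟩ := ih
      suffices hs : ∃ h : (Fin (d i.castSucc) → k) ≃ₗ[k] (Fin (d i.castSucc) → k),
          (∀ j, ∀ v ∈ natFilt V i.castSucc j, h v ∈ natFilt V' i.castSucc j) ∧
          (∀ v, e i.succ (rightStep V i v) = rightStep V' i (h v)) ∧
          ∀ v, h (leftStep V i v) = leftStep V' i (e i.succ v) by
        obtain ⟨h, h1, h2, h3⟩ := hs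
        refine ⟨Function.update e i.castSucc h, ?_, fun j hj => ?_⟩
        · rw [Function.update_self]
          exact forall_filt_of_forall_natFilt h1
        · have hjs : j.succ ≠ i.castSucc := (hj.trans_lt Fin.castSucc_lt_succ).ne'
          rw [Function.update_of_ne hjs]
          rcases hj.eq_or_lt with hij | hij
          · obtain rfl := Fin.castSucc_injective _ hij
            rw [Function.update_self]
            exact ⟨h2, h3⟩
          · rw [Function.update_of_ne hij.ne']
            exact hc j (Fin.castSucc_lt_iff_succ_le.1 hij)
      rcases ho : o i with _ | _
      · obtain ⟨h, h1, h2⟩ := exists_filtered_extension (natFilt_mono V i.castSucc)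
          (natFilt_mono V' i.castSucc) (natFilt_zero V _) (natFilt_zero V' _) (natFilt_top V _)
          (natFilt_top V' _) (fun i => hd _ _) (leftStep V i) (leftStep V' i) (fun j => by
            unfold natFilt
            rw [comap_leftStep_filt V ho, comap_leftStep_filt V' ho, hd]) (e i.succ) (fun j => by
            unfold natFilt
            rw [comap_leftStep_filt V ho, comap_leftStep_filt V' ho]
            exact he _)
        refine ⟨h, h1, fun v => ?_, h2⟩
        rw [rightStep_of_false V ho, rightStep_of_false V' ho]
        simp
      · obtain ⟨h, h1, h2⟩ := exists_filtered_lift (natFilt_mono V i.castSucc)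
          (natFilt_mono V' i.castSucc) (natFilt_top V _)
          (natFilt_top V' _) (fun i => hd _ _) (rightStep V i) (rightStep V' i) (fun j => by
            unfold natFilt
            rw [map_rightStep_filt V ho, map_rightStep_filt V' ho, hd]) (e i.succ) (fun j => by
            unfold natFilt
            rw [map_rightStep_filt V ho, map_rightStep_filt V' ho]
            exact he _)
        refine ⟨h, h1, fun v => (h2 v).symm, fun v => ?_⟩
        rw [leftStep_of_true V ho, leftStep_of_true V' ho]
        simp
  obtain ⟨e, -, he⟩ := key 0
  exact ⟨e, fun i => he i (Fin.zero_le _)⟩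

/-- An invertible linear map as an invertible matrix. -/
noncomputable def glOfEquiv {m : ℕ} (e : (Fin m → k) ≃ₗ[k] (Fin m → k)) : GL (Fin m) k where
  val := LinearMap.toMatrix' e.toLinearMap
  inv := LinearMap.toMatrix' e.symm.toLinearMap
  val_inv := by rw [← LinearMap.toMatrix'_comp]; simp
  inv_val := by rw [← LinearMap.toMatrix'_comp]; simp

theorem glOfEquiv_mulVec {m : ℕ} (e : (Fin m → k) ≃ₗ[k] (Fin m → k)) (v : Fin m → k) :
    (glOfEquiv e).val.mulVec v = e v := LinearMap.toMatrix'_mulVec _ _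

/-- Representations whose Zelevinsky matrices have the same ranks lie in one orbit. -/
theorem mem_orbit_of_blockRank_eq {V V' : Rep k o d}
    (hr : ∀ c i, blockRank o (zetaBlock V) c i = blockRank o (zetaBlock V') c i) :
    V' ∈ MulAction.orbit (GLd k d) V := by
  obtain ⟨e, he⟩ := exists_equiv_of_blockRank_eq hr
  refine ⟨fun x => glOfEquiv (e x), ?_⟩
  ext i h : 3
  · change (glOfEquiv (e i.succ)).val * V.B i h * (glOfEquiv (e i.castSucc))⁻¹.val = V'.B i h
    suffices hs : (glOfEquiv (e i.succ)).val * V.B i h =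
        V'.B i h * (glOfEquiv (e i.castSucc)).val by
      rw [hs, Matrix.mul_assoc, Units.mul_inv, Matrix.mul_one]
    refine Matrix.ext_of_mulVec_single fun j => ?_
    have := (he i).1 (Pi.single j 1)
    simp only [rightStep, h, dif_pos, Matrix.mulVecLin_apply] at this
    rw [← Matrix.mulVec_mulVec, ← Matrix.mulVec_mulVec, glOfEquiv_mulVec, glOfEquiv_mulVec, this]
  · change (glOfEquiv (e i.castSucc)).val * V.A i h * (glOfEquiv (e i.succ))⁻¹.val = V'.A i h
    suffices hs : (glOfEquiv (e i.castSucc)).val * V.A i h =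
        V'.A i h * (glOfEquiv (e i.succ)).val by
      rw [hs, Matrix.mul_assoc, Units.mul_inv, Matrix.mul_one]
    refine Matrix.ext_of_mulVec_single fun j => ?_
    have := (he i).2 (Pi.single j 1)
    simp only [leftStep, h, dif_pos, Matrix.mulVecLin_apply] at this
    rw [← Matrix.mulVec_mulVec, ← Matrix.mulVec_mulVec, glOfEquiv_mulVec, glOfEquiv_mulVec, this]

theorem rightStep_smul (g : GLd k d) (V : Rep k o d) (i : Fin n) (v : Fin (d i.castSucc) → k) :
    rightStep (g • V) i ((g i.castSucc).val.mulVec v) =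
      (g i.succ).val.mulVec (rightStep V i v) := by
  unfold rightStep
  split_ifs with h
  · change ((g i.succ).val * V.B i h * (g i.castSucc)⁻¹.val).mulVec _ = _
    rw [Matrix.mulVec_mulVec, Matrix.mul_assoc, Units.inv_mul, Matrix.mul_one,
      ← Matrix.mulVec_mulVec]
    rfl
  · simp

theorem leftStep_smul (g : GLd k d) (V : Rep k o d) (i : Fin n) (v : Fin (d i.succ) → k) :
    leftStep (g • V) i ((g i.succ).val.mulVec v) =
      (g i.castSucc).val.mulVec (leftStep V i v) := by
  unfold leftStep
  split_ifs with h
  · change ((g i.castSucc).val * V.A i h * (g i.succ)⁻¹.val).mulVec _ = _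
    rw [Matrix.mulVec_mulVec, Matrix.mul_assoc, Units.inv_mul, Matrix.mul_one,
      ← Matrix.mulVec_mulVec]
    rfl
  · simp

/-- The action of `GL(d)` on `⨁ₓ k ^ d x`. -/
def actLin (g : GLd k d) : Vec k d →ₗ[k] Vec k d :=
  LinearMap.pi fun x => (g x).val.mulVecLin ∘ₗ LinearMap.proj x

theorem actLin_apply (g : GLd k d) (w : Vec k d) (x : Fin (n + 1)) :
    actLin g w x = (g x).val.mulVec (w x) := rfl

theorem oneSubRight_smul (g : GLd k d) (V : Rep k o d) (w : Vec k d) (x : Fin (n + 1)) :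
    oneSubRight (g • V) (actLin g w) x = (g x).val.mulVec (oneSubRight V w x) := by
  cases x using Fin.cases with
  | zero => rw [oneSubRight_zero, oneSubRight_zero, actLin_apply]
  | succ i =>
    rw [oneSubRight_succ, oneSubRight_succ, actLin_apply, actLin_apply, rightStep_smul,
      Matrix.mulVec_sub]

theorem oneAddLeft_smul (g : GLd k d) (V : Rep k o d) (w : Vec k d) (x : Fin (n + 1)) :
    oneAddLeft (g • V) (actLin g w) x = (g x).val.mulVec (oneAddLeft V w x) := by
  cases x using Fin.lastCases with
  | last => rw [oneAddLeft_last, oneAddLeft_last, actLin_apply]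
  | cast i =>
    rw [oneAddLeft_castSucc, oneAddLeft_castSucc, actLin_apply, actLin_apply, leftStep_smul,
      Matrix.mulVec_add]

theorem actLin_injective (g : GLd k d) : Function.Injective (actLin g) := by
  intro a b h
  funext x
  have hx := congrFun h x
  rw [actLin_apply, actLin_apply] at hx
  have := congrArg ((g x)⁻¹.val.mulVec) hx
  rwa [Matrix.mulVec_mulVec, Matrix.mulVec_mulVec, Units.inv_mul, Matrix.one_mulVec,
    Matrix.one_mulVec] at this

/-- `g` embeds the null space of `V` into that of `g • V`, and the number of columns is the same. -/
theorem blockRank_smul_le (g : GLd k d) (V : Rep k o d) (c i : ℤ) :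
    blockRank o (zetaBlock (g • V)) c i ≤ blockRank o (zetaBlock V) c i := by
  have hle : (nullSpace o (oneSubRight V) (oneAddLeft V) c i).map (actLin g) ≤
      nullSpace o (oneSubRight (g • V)) (oneAddLeft (g • V)) c i := by
    rintro _ ⟨w, hw, rfl⟩
    refine ⟨fun x hx => ?_, fun x hx => ?_⟩
    · rw [oneSubRight_smul, hw.1 x hx, Matrix.mulVec_zero]
    · rw [oneAddLeft_smul, hw.2 x hx, Matrix.mulVec_zero]
  have hf := Submodule.finrank_mono hle
  rw [← (Submodule.equivMapOfInjective _ (actLin_injective g) _).finrank_eq] at hf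
  have h1 := finrank_nullSpace_add_zeta V c i
  have h2 := finrank_nullSpace_add_zeta (g • V) c i
  omega

theorem blockRank_smul (g : GLd k d) (V : Rep k o d) (c i : ℤ) :
    blockRank o (zetaBlock (g • V)) c i = blockRank o (zetaBlock V) c i := by
  refine le_antisymm (blockRank_smul_le g V c i) ?_
  have := blockRank_smul_le g⁻¹ (g • V) c i
  rwa [inv_smul_smul] at this

end Isomorphism

end TypeA

theorem mainTheorem6 {k : Type*} [Field k] {n : ℕ} (o : Fin n → Bool) (d : Fin (n + 1) → ℕ)
    (hd : ∀ x, d x ≠ 0) (r : Fin (n + 1) → Fin (n + 1) → ℕ)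
    (O : Set (TypeA.Rep k o d)) (hO : TypeA.IsOrbitOf O r) :
    (fun V : TypeA.Rep k o d => TypeA.toFlag (TypeA.zeta V)) '' O =
        (⋃ w ∈ TypeA.zp1 O, TypeA.schubertCell k (TypeA.seq₂ o) w) ∩
          TypeA.oppCell k (TypeA.seq₂ o) (TypeA.vQ o d) ∧
      (⋃ w ∈ TypeA.zp1 O, TypeA.schubertCell k (TypeA.seq₂ o) w) ∩
          TypeA.oppCell k (TypeA.seq₂ o) (TypeA.vQ o d) =
        ⋃ w ∈ TypeA.zp1 O, TypeA.schubertCell k (TypeA.seq₂ o) w ∩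
          TypeA.oppCell k (TypeA.seq₂ o) (TypeA.vQ o d) := by
  refine ⟨?_, by simp only [Set.iUnion_inter]⟩
  obtain ⟨V₀, -, rfl⟩ := hO
  have horb : ∀ V ∈ MulAction.orbit (TypeA.GLd k d) V₀, ∀ x y,
      TypeA.swRank (TypeA.seq₁ o) (TypeA.seq₂ o) (TypeA.zetaMatrix V) x y =
        TypeA.swRank (TypeA.seq₁ o) (TypeA.seq₂ o) (TypeA.zetaMatrix V₀) x y := by
    rintro _ ⟨g, rfl⟩ x y
    rw [TypeA.zetaMatrix, TypeA.zetaMatrix, TypeA.swRank_blocked, TypeA.swRank_blocked]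
    exact TypeA.blockRank_smul g V₀ _ _
  refine Set.Subset.antisymm ?_ ?_
  · rintro _ ⟨V, hV, rfl⟩
    refine ⟨?_, TypeA.toFlag_mem_oppCell _⟩
    -- Any `w ∈ W^P` whose cell contains the point has its ranks, which are those of the whole
    -- orbit.
    obtain ⟨w, hw, hmem⟩ := TypeA.exists_mem_schubertCell (TypeA.seq₂ o)
      (TypeA.toFlag (TypeA.zeta V))
    refine Set.mem_biUnion (show w ∈ TypeA.zp1 _ from ⟨hw, fun V' hV' x y => ?_⟩) hmem
    rw [← TypeA.swRank_eq_of_mem_schubertCell hmem, horb V' hV', ← horb V hV]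
    rfl
  · rintro q ⟨hq, hopp⟩
    obtain ⟨w, hw, hq⟩ := Set.mem_iUnion₂.1 hq
    obtain ⟨⟨M, hM⟩, rfl⟩ := TypeA.exists_toFlag_eq hopp
    -- Conversely, a point in the cell of such a `w` has the ranks of `ζ(V₀)`; it remains to find
    -- `V` in the orbit.
    have hrank : ∀ x y, TypeA.swRank (TypeA.seq₁ o) (TypeA.seq₂ o) M x y =
        TypeA.swRank (TypeA.seq₁ o) (TypeA.seq₂ o) (TypeA.zetaMatrix V₀) x y := by
      intro x y
      rw [← hw.2 V₀ (MulAction.mem_orbit_self V₀), ← TypeA.swRank_eq_of_mem_schubertCell hq]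
      rfl
    obtain ⟨F, h1, h0, rfl⟩ := id hM
    have hF : TypeA.IsCellBlocks o F := ⟨h1, fun x y hxy => h0 x y (hxy.imp
      (TypeA.symm_sort_lt_iff (TypeA.key₂_injective o)).2
      (TypeA.symm_sort_lt_iff (TypeA.key₁_injective o)).2)⟩
    have hr := TypeA.blockRank_eq_of_swRank_eq hrank
    obtain ⟨V, rfl⟩ := TypeA.exists_eq_zetaBlock hF V₀ hr
    exact ⟨V, TypeA.mem_orbit_of_blockRank_eq fun c i => (hr c i).symm, rfl⟩
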